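/- Let $\psi=\Gamma'/\Gamma$ be the digamma function, $H_r=\sum_{i=1}^r \frac1i$, let $G=\sum_{k=0}^\infty\frac{(-1)^k}{(2k+1)^2}$ be Catalan's constant, and let $\mathrm{Li}_3$ be the trilogarithm, i.e. the analytic continuation of $\sum_{k\ge1} z^k/k^3$ from the unit disc to $\mathbb{C}\setminus[1,\infty)$. Let $m$ and $n$ be positive integers with $n\ge m$. Then the series $$\Theta_1(n,2m)=\sum_{k=1}^\infty \frac{\psi\left(\frac{2k+2n+5}{4}\right)-\psi\left(\frac{2k+2n+3}{4}\right)}{(2k+2m)^2}$$ converges, and its value is as follows (empty sums are $0$). (1) If $n=m$: $$\Theta_1(n,2m)=-4-\sum_{k=1}^m\sum_{j=0}^k\frac{(-1)^{k+j}}{k^2(2j+1)}+4\ln 2-\left(\frac12\ln^2 2+\sum_{k=1}^m\frac{(-1)^{k-1}}{4k^2}\right)\pi+\frac{\pi^2}{6}-\frac{11\pi^3}{48}-4G\ln 2+8\,\mathrm{Im}\,\mathrm{Li}_3(1+i).$$ (2) If $n=m+1$: $$\Theta_1(n,2m)=\frac{92}{27}+\sum_{k=1}^m\sum_{j=0}^{k+1}\frac{(-1)^{k+j}}{k^2(2j+1)}+\left(\frac12\ln^2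 2-\sum_{k=1}^m\frac{(-1)^k}{4k^2}\right)\pi-\frac{\pi^2}{9}+\frac{11\pi^3}{48}+4G\ln 2-\frac{32\ln 2}{9}-8\,\mathrm{Im}\,\mathrm{Li}_3(1+i).$$ (3) If $n-m$ is odd and $n-m\neq1$, then with $N=\frac{n-m-1}{2}$: $$\begin{aligned}\Theta_1(n,2m)={}&\frac{92}{27}+16\sum_{j=1}^{N}\frac{(2j+1)(2H_{4j+1}-H_{2j})}{(4j+3)^2(4j+1)^2}-4\sum_{j=1}^{N}\frac1{(4j+3)^3}-\sum_{k=1}^m\sum_{j=0}^{k+n-m}\frac{(-1)^{j+k+n-m}}{k^2(2j+1)}\\&+\left(\frac12\ln^2 2+(-1)^{n-m}\sum_{k=1}^m\frac{(-1)^k}{4k^2}\right)\pi-\pi^2\left(\frac19+\frac13\sum_{j=1}^{N}\frac1{(4j+3)(4j+1)}\right)\\&-\ln 2\left(\frac{32}{9}+32\sum_{j=1}^{N}\frac{2j+1}{(4j+3)^2(4j+1)^2}\right)+\frac{11\pi^3}{48}+4G\ln 2-8\,\mathrm{Im}\,\mathrm{Li}_3(1+i).\end{aligned}$$ (4) If $n-m$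 is even, then with $N=\frac{n-m-2}{2}$: $$\begin{aligned}\Theta_1(n,2m)={}&-4+32\sum_{j=0}^{N}\frac{(j+1)(2H_{4j+3}-H_{2j+1})}{(4j+5)^2(4j+3)^2}-4\sum_{j=0}^{N}\frac1{(4j+5)^3}-\sum_{k=1}^m\sum_{j=0}^{k+n-m}\frac{(-1)^{j+k+n-m}}{k^2(2j+1)}\\&+\left(-\frac12\ln^2 2+(-1)^{n-m}\sum_{k=1}^m\frac{(-1)^k}{4k^2}\right)\pi+\pi^2\left(\frac16-\frac13\sum_{j=0}^{N}\frac1{(4j+5)(4j+3)}\right)\\&+\ln 2\left(4-64\sum_{j=0}^{N}\frac{j+1}{(4j+5)^2(4j+3)^2}\right)-\frac{11\pi^3}{48}-4G\ln 2+8\,\mathrm{Im}\,\mathrm{Li}_3(1+i).\end{aligned}$$ -/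

import Mathlib

/-- Catalan's constant `G = ∑_{k ≥ 0} (-1)^k / (2k+1)^2` (an absolutely convergent series). -/
noncomputable def catalanG : ℝ := ∑' k : ℕ, (-1 : ℝ) ^ k / (2 * (k : ℝ) + 1) ^ 2

/-- The trilogarithm `Li₃` on the cut plane `ℂ ∖ [1, ∞)` (principal branch), through its
standard integral representation `Li₃(z) = (z / Γ(3)) ∫_0^1 (ln x)^2 / (1 - z x) dx`.
The lemmas `hasSum_trilog` and `differentiableOn_trilog` below show that it is the analytic
continuation of `∑_{k ≥ 1} z^k / k^3` from the unit disc to the cut plane. -/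
noncomputable def trilog (z : ℂ) : ℂ :=
  ∫ x : ℝ in (0 : ℝ)..1, ((Real.log x ^ 2 / 2 : ℝ) : ℂ) * (z / (1 - z * (x : ℂ)))

/-- The `k`-th term, `k ≥ 1`, of the series `Θ₁(n, α)`:
`(ψ((2k+2n+5)/4) - ψ((2k+2n+3)/4)) / (2k+α)^2`, where `ψ` is the digamma function. -/
noncomputable def theta1Term (n α k : ℕ) : ℂ :=
  (Complex.digamma ((2 * (k : ℂ) + 2 * (n : ℂ) + 5) / 4)
    - Complex.digamma ((2 * (k : ℂ) + 2 * (n : ℂ) + 3) / 4)) / (2 * (k : ℂ) + (α : ℂ)) ^ 2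

theorem trilog_aux (k : ℕ) :
    IntervalIntegrable (fun x : ℝ => x ^ k * Real.log x ^ 2) MeasureTheory.volume 0 1 ∧
      ∫ x : ℝ in (0 : ℝ)..1, x ^ k * Real.log x ^ 2 = 2 / ((k : ℝ) + 1) ^ 3 := by
  have hk : (k : ℝ) + 1 ≠ 0 := by positivity
  let F : ℝ → ℝ := fun x => x ^ k * (2 * (Real.sqrt x * Real.log (Real.sqrt x))) ^ 2 / ((k : ℝ) + 1)
    - 2 * (x ^ k * (x * Real.log x)) / ((k : ℝ) + 1) ^ 2 + 2 * x ^ (k + 1) / ((k : ℝ) + 1) ^ 3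
  have hF : Continuous F := by
    have h1 := Real.continuous_mul_log
    have h2 : Continuous fun x : ℝ => Real.sqrt x * Real.log (Real.sqrt x) :=
      h1.comp Real.continuous_sqrt
    fun_prop
  have hd : ∀ x ∈ Set.Ioo (0 : ℝ) 1, HasDerivAt F (x ^ k * Real.log x ^ 2) x := by
    intro x hx
    have hx0 : x ≠ 0 := hx.1.ne'
    have hl := Real.hasDerivAt_log hx0
    have hp : HasDerivAt (fun x : ℝ => x ^ (k + 1)) (((k : ℝ) + 1) * x ^ k) x := by
      simpa using hasDerivAt_pow (k + 1) x
    have h := (((hp.mul (hl.pow 2)).div_const ((k : ℝ) + 1)).sub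
      (((hp.mul hl).const_mul 2).div_const (((k : ℝ) + 1) ^ 2))).add
      ((hp.const_mul 2).div_const (((k : ℝ) + 1) ^ 3))
    refine (h.congr_of_eventuallyEq ?_).congr_deriv ?_
    · filter_upwards [lt_mem_nhds hx.1] with y hy
      have hs : Real.sqrt y ^ 2 = y := Real.sq_sqrt hy.le
      simp only [F, Pi.add_apply, Pi.sub_apply, Pi.mul_apply, Pi.pow_apply]
      rw [Real.log_sqrt hy.le, mul_pow, mul_pow, hs]
      ring
    · simp only [Pi.pow_apply]
      field_simp
      ring
  have hi : IntervalIntegrable (fun x : ℝ => x ^ k * Real.log x ^ 2) MeasureTheory.volume 0 1 := by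
    refine intervalIntegral.intervalIntegrable_deriv_of_nonneg hF.continuousOn ?_ ?_
    · simpa using hd
    · intro x hx
      have : 0 < x := by simpa using hx.1
      positivity
  refine ⟨hi, ?_⟩
  rw [intervalIntegral.integral_eq_sub_of_hasDerivAt_of_le zero_le_one hF.continuousOn hd hi]
  simp [F]

theorem hasSum_trilog {z : ℂ} (hz : ‖z‖ < 1) :
    HasSum (fun k : ℕ => z ^ (k + 1) / ((k : ℂ) + 1) ^ 3) (trilog z) := by
  let F : ℕ → ℝ → ℂ := fun k x => ((x ^ k * Real.log x ^ 2 : ℝ) : ℂ) * (z ^ (k + 1) / 2)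
  have hint : ∀ k, ∫ x in Set.Ioc (0 : ℝ) 1, F k x = z ^ (k + 1) / ((k : ℂ) + 1) ^ 3 := by
    intro k
    have h := (trilog_aux k).2
    rw [intervalIntegral.integral_of_le zero_le_one] at h
    simp only [F]
    rw [MeasureTheory.integral_mul_const, integral_complex_ofReal, h]
    push_cast
    ring
  have hI : ∀ k, MeasureTheory.Integrable (F k)
      (MeasureTheory.volume.restrict (Set.Ioc (0 : ℝ) 1)) := by
    intro k
    have h := (trilog_aux k).1
    rw [intervalIntegrable_iff_integrableOn_Ioc_of_le zero_le_one] at h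
    exact (h.ofReal (𝕜 := ℂ)).mul_const _
  have hnorm : ∀ k, ∫ x in Set.Ioc (0 : ℝ) 1, ‖F k x‖ = ‖z‖ ^ (k + 1) / ((k : ℝ) + 1) ^ 3 := by
    intro k
    have h := (trilog_aux k).2
    rw [intervalIntegral.integral_of_le zero_le_one] at h
    have : ∫ x in Set.Ioc (0 : ℝ) 1, ‖F k x‖
        = ∫ x in Set.Ioc (0 : ℝ) 1, (x ^ k * Real.log x ^ 2) * (‖z‖ ^ (k + 1) / 2) := by
      refine MeasureTheory.setIntegral_congr_fun measurableSet_Ioc ?_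
      intro x hx
      have hx0 : 0 < x := hx.1
      have : 0 ≤ x ^ k * Real.log x ^ 2 := by positivity
      simp only [F, norm_mul, Complex.norm_real, Real.norm_of_nonneg this, norm_div, norm_pow,
        Complex.norm_ofNat]
    rw [this, MeasureTheory.integral_mul_const, h]
    ring
  have hs : Summable fun k => ∫ x in Set.Ioc (0 : ℝ) 1, ‖F k x‖ := by
    simp only [hnorm]
    refine Summable.of_nonneg_of_le (fun k => by positivity) (fun k => ?_)
      ((summable_geometric_of_lt_one (norm_nonneg z) hz))
    refine (div_le_self (by positivity) (one_le_pow₀ (by simp))).trans ?_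
    exact pow_le_pow_of_le_one (norm_nonneg z) hz.le (Nat.le_succ k)
  have key := MeasureTheory.hasSum_integral_of_summable_integral_norm hI hs
  simp only [hint] at key
  suffices hE : trilog z = ∫ x in Set.Ioc (0 : ℝ) 1, ∑' k, F k x by rwa [hE]
  rw [trilog, intervalIntegral.integral_of_le zero_le_one]
  refine MeasureTheory.setIntegral_congr_fun measurableSet_Ioc ?_
  intro x hx
  have hzx : ‖z * (x : ℂ)‖ < 1 := by
    rw [norm_mul, Complex.norm_real, Real.norm_of_nonneg hx.1.le]
    exact (mul_le_of_le_one_right (norm_nonneg z) hx.2).trans_lt hz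
  have h := ((hasSum_geometric_of_norm_lt_one hzx).mul_left
    (((Real.log x ^ 2 / 2 : ℝ) : ℂ) * z)).tsum_eq
  simp only [div_eq_mul_inv z, ← mul_assoc, ← h]
  refine tsum_congr fun k => ?_
  simp only [F]
  push_cast
  ring

theorem differentiableOn_trilog :
    DifferentiableOn ℂ trilog {z : ℂ | ∀ t : ℝ, 1 ≤ t → z ≠ (t : ℂ)} := by
  intro z hz
  have hne : ∀ x ∈ Set.Icc (0 : ℝ) 1, 1 - z * (x : ℂ) ≠ 0 := by
    intro x hx h
    have hx0 : x ≠ 0 := by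
      rintro rfl
      simp at h
    have hx1 : 0 < x := lt_of_le_of_ne hx.1 (Ne.symm hx0)
    refine hz x⁻¹ ((one_le_inv₀ hx1).2 hx.2) ?_
    have hc : (x : ℂ) ≠ 0 := by exact_mod_cast hx0
    push_cast
    field_simp
    linear_combination -h
  obtain ⟨x0, hx0, hmin⟩ := (isCompact_Icc (a := (0 : ℝ)) (b := 1)).exists_isMinOn
    (Set.nonempty_Icc.2 zero_le_one)
    (f := fun x : ℝ => ‖1 - z * (x : ℂ)‖) (by fun_prop)
  set c := ‖1 - z * (x0 : ℂ)‖ with hc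
  have hc0 : 0 < c := norm_pos_iff.2 (hne x0 hx0)
  have hlow : ∀ w ∈ Metric.ball z (c / 2), ∀ x ∈ Set.Ioc (0 : ℝ) 1,
      c / 2 ≤ ‖1 - w * (x : ℂ)‖ := by
    intro w hw x hx
    have h1 : c ≤ ‖1 - z * (x : ℂ)‖ := hmin (Set.Ioc_subset_Icc_self hx)
    have h2 : ‖(w - z) * (x : ℂ)‖ ≤ c / 2 := by
      rw [norm_mul, Complex.norm_real, Real.norm_of_nonneg hx.1.le]
      have := (mem_ball_iff_norm.1 hw).le
      exact (mul_le_of_le_one_right (norm_nonneg _) hx.2).trans this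
    have h3 : 1 - z * (x : ℂ) = (1 - w * (x : ℂ)) + (w - z) * (x : ℂ) := by ring
    have h4 := norm_add_le (1 - w * (x : ℂ)) ((w - z) * (x : ℂ))
    rw [← h3] at h4
    linarith
  have hlog : MeasureTheory.IntegrableOn (fun x : ℝ => Real.log x ^ 2) (Set.Ioc (0 : ℝ) 1) := by
    have h := (trilog_aux 0).1
    rw [intervalIntegrable_iff_integrableOn_Ioc_of_le zero_le_one] at h
    simpa using h
  let F : ℂ → ℝ → ℂ := fun w x => ((Real.log x ^ 2 / 2 : ℝ) : ℂ) * (w / (1 - w * (x : ℂ)))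
  let F' : ℂ → ℝ → ℂ := fun w x => ((Real.log x ^ 2 / 2 : ℝ) : ℂ) * (1 / (1 - w * (x : ℂ)) ^ 2)
  have hFm : ∀ w, Measurable (F w) := fun w => by
    simp only [F]
    fun_prop
  have hF'm : ∀ w, Measurable (F' w) := fun w => by
    simp only [F']
    fun_prop
  have hFi : MeasureTheory.Integrable (F z)
      (MeasureTheory.volume.restrict (Set.Ioc (0 : ℝ) 1)) := by
    refine MeasureTheory.Integrable.mono' (hlog.mul_const (‖z‖ / c))
      (hFm z).aestronglyMeasurable ?_
    refine (MeasureTheory.ae_restrict_iff' measurableSet_Ioc).2 (Filter.Eventually.of_forall ?_)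
    intro x hx
    have h1 : c ≤ ‖1 - z * (x : ℂ)‖ := hmin (Set.Ioc_subset_Icc_self hx)
    have h2 : (0 : ℝ) ≤ Real.log x ^ 2 := by positivity
    rw [norm_mul, norm_div z, Complex.norm_real,
      Real.norm_of_nonneg (by positivity : (0 : ℝ) ≤ Real.log x ^ 2 / 2)]
    gcongr
    linarith
  have key := hasDerivAt_integral_of_dominated_loc_of_deriv_le
    (μ := MeasureTheory.volume.restrict (Set.Ioc (0 : ℝ) 1)) (F := F) (F' := F') (x₀ := z)
    (bound := fun x => Real.log x ^ 2 * (1 / (c / 2) ^ 2))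
    (Metric.ball_mem_nhds z (half_pos hc0))
    (Filter.Eventually.of_forall fun w => (hFm w).aestronglyMeasurable) hFi
    (hF'm z).aestronglyMeasurable
    ((MeasureTheory.ae_restrict_iff' measurableSet_Ioc).2 (Filter.Eventually.of_forall (by
      intro x hx w hw
      have h1 := hlow w hw x hx
      have h2 : (0 : ℝ) ≤ Real.log x ^ 2 := by positivity
      rw [norm_mul, norm_div 1, norm_pow, norm_one, Complex.norm_real,
        Real.norm_of_nonneg (by positivity : (0 : ℝ) ≤ Real.log x ^ 2 / 2)]
      gcongr
      linarith)))
    (hlog.mul_const _)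
    ((MeasureTheory.ae_restrict_iff' measurableSet_Ioc).2 (Filter.Eventually.of_forall (by
      intro x hx w hw
      have h1 : 1 - w * (x : ℂ) ≠ 0 :=
        norm_pos_iff.1 ((half_pos hc0).trans_le (hlow w hw x hx))
      have h2 : HasDerivAt (fun w : ℂ => 1 - w * (x : ℂ)) (-(x : ℂ)) w := by
        simpa using ((hasDerivAt_id w).mul_const (x : ℂ)).const_sub 1
      refine (((hasDerivAt_id w).div h2 h1).const_mul
        (((Real.log x ^ 2 / 2 : ℝ) : ℂ))).congr_deriv ?_
      simp only [F', id]
      congr 2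
      ring)))
  have h := key.2.differentiableAt
  have he : trilog = fun w => ∫ x in Set.Ioc (0 : ℝ) 1, F w x := by
    funext w
    rw [trilog, intervalIntegral.integral_of_le zero_le_one]
  rw [he]
  exact h.differentiableWithinAt

/-! Put c_r = ∫_0^1 t^(2r)/(1+t²) dt. A digamma difference at arguments half a unit apart is 4c_r
(`realDigamma_sub_eq`), so with n = m + d and K = k + m the series is the part K > m of S(d+1),
where S(r) = ∑_{K≥1} c_{K+r}/K² (`hasSum_theta1Term`). The missing terms K ≤ m are elementary, since
c_r is a signed tail of the Leibniz series (`arctanMoment_eq`); they give the double sum and a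
rational multiple of π.

From c_r + c_{r+1} = 1/(2r+1) it follows that S(r) + S(r+1) = ∑ 1/(K²(2K+2r+1))
(`momentSum_add_succ`), which partial fractions reduce to π², log 2 and rationals
(`hasSum_mixedSum`). Everything thus reduces to S(0), and the parity of d decides the sign with
which S(0) enters.

Summing under the integral, S(0) = ∫_0^1 Li₂(t²)/(1+t²) dt. Integration by parts leaves 2∫ arctan t
· log(1-t²)/t dt, whose integrand is the imaginary part of (2A² - B² - C²)/t with A = log(1+it), B =
log((1-t)/(1+it)), C = log((1+it)/(1+t)). Each of A²/t, B²/t, C²/t has an explicit primitive in Li₂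
and Li₃, because Möbius changes of variable carry dt/t to forms with simple poles. At t → 1 only Li₂
and Li₃ at (1-i)/2 and its conjugate survive. The former has a closed form
(`dilogSeries_one_sub_I_div_two`); as (1-i)/2 = 1/(1+i), the inversion formula on the cut plane
expresses the imaginary part of the latter through Im Li₃(1+i) (`trilog_one_add_I_im`). -/

/-! ### Digamma differences as moments of 1/(1+t²) -/

/-- The digamma function on the positive reals, as the derivative of `log Γ`. -/
noncomputable def realDigamma (x : ℝ) : ℝ := deriv (Real.log ∘ Real.Gamma) x

theorem differentiableAt_log_Gamma {x : ℝ} (hx : 0 < x) :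
    DifferentiableAt ℝ (Real.log ∘ Real.Gamma) x :=
  (Real.differentiableAt_Gamma fun m => by
    have : (0 : ℝ) ≤ m := Nat.cast_nonneg m
    linarith).log (Real.Gamma_pos_of_pos hx).ne'

/-- The complex derivative of Γ along the real axis is also a derivative of the real Γ, and
derivatives are unique. Passing to the reals makes order arguments available. -/
theorem digamma_ofReal {x : ℝ} (hx : 0 < x) :
    Complex.digamma (x : ℂ) = (realDigamma x : ℂ) := by
  have hm : ∀ m : ℕ, x ≠ -m := fun m => by
    have : (0 : ℝ) ≤ m := Nat.cast_nonneg m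
    linarith
  have hr : HasDerivAt Real.Gamma (deriv Real.Gamma x) x :=
    (Real.differentiableAt_Gamma hm).hasDerivAt
  have hc : HasDerivAt Complex.Gamma (deriv Complex.Gamma x) (x : ℂ) :=
    (Complex.differentiableAt_Gamma _ fun m => by exact_mod_cast hm m).hasDerivAt
  have h1 := hc.comp_ofReal
  have h2 := hr.ofReal_comp
  simp only [Complex.Gamma_ofReal] at h1
  have h3 := h1.unique h2
  have h4 : realDigamma x = deriv Real.Gamma x / Real.Gamma x :=
    (hr.log (Real.Gamma_pos_of_pos hx).ne').deriv
  rw [Complex.digamma_def, logDeriv_apply, h3, h4, Complex.Gamma_ofReal]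
  push_cast
  rfl

theorem realDigamma_add_one {x : ℝ} (hx : 0 < x) :
    realDigamma (x + 1) = realDigamma x + 1 / x := by
  have hm : ∀ m : ℕ, (x : ℂ) ≠ -m := fun m h => by
    have h1 : x = -m := by exact_mod_cast h
    have : (0 : ℝ) ≤ m := Nat.cast_nonneg m
    linarith
  have h := Complex.digamma_apply_add_one (x : ℂ) hm
  have h1 := digamma_ofReal (x := x + 1) (by linarith)
  push_cast at h1
  rw [h1, digamma_ofReal hx] at h
  rw [one_div]
  exact_mod_cast h

/-- Log-convexity of Γ. Together with the functional equation, this replaces any asymptotic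
expansion of ψ in the limits below. -/
theorem monotoneOn_realDigamma : MonotoneOn realDigamma (Set.Ioi 0) :=
  Real.convexOn_log_Gamma.monotoneOn_deriv fun _ hx => differentiableAt_log_Gamma hx

/-- The moments `∫_0^1 t^(2r) / (1 + t²) dt`. -/
noncomputable def arctanMoment (r : ℕ) : ℝ := ∫ t : ℝ in (0 : ℝ)..1, t ^ (2 * r) / (1 + t ^ 2)

theorem continuous_pow_div_one_add_sq (r : ℕ) :
    Continuous fun t : ℝ => t ^ r / (1 + t ^ 2) :=
  (continuous_pow r).div (by fun_prop) fun t => by positivity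

theorem arctanMoment_zero : arctanMoment 0 = Real.pi / 4 := by
  simp [arctanMoment]

theorem arctanMoment_add_succ (r : ℕ) :
    arctanMoment r + arctanMoment (r + 1) = 1 / (2 * (r : ℝ) + 1) := by
  rw [arctanMoment, arctanMoment, ← intervalIntegral.integral_add
    ((continuous_pow_div_one_add_sq _).intervalIntegrable _ _)
    ((continuous_pow_div_one_add_sq _).intervalIntegrable _ _)]
  have : ∀ t : ℝ, t ^ (2 * r) / (1 + t ^ 2) + t ^ (2 * (r + 1)) / (1 + t ^ 2) = t ^ (2 * r) := by
    intro t
    have : 1 + t ^ 2 ≠ 0 := by positivity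
    field_simp
    ring
  simp only [this, integral_pow]
  simp

theorem arctanMoment_nonneg (r : ℕ) : 0 ≤ arctanMoment r :=
  intervalIntegral.integral_nonneg zero_le_one fun t ht => by
    have := ht.1
    positivity

theorem arctanMoment_le (r : ℕ) : arctanMoment r ≤ 1 / (2 * (r : ℝ) + 1) := by
  have := arctanMoment_add_succ r
  have := arctanMoment_nonneg (r + 1)
  linarith

/-- The moment `arctanMoment r` is `±` the tail of the Leibniz series. -/
theorem arctanMoment_eq (r : ℕ) :
    arctanMoment r = (-1) ^ r * (Real.pi / 4 - ∑ j ∈ Finset.range r, (-1) ^ j / (2 * (j : ℝ) + 1)) := by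
  induction r with
  | zero => simp [arctanMoment_zero]
  | succ r ih =>
    have h := arctanMoment_add_succ r
    have h1 : ((-1 : ℝ) ^ r) * (-1) ^ r = 1 := by rw [← mul_pow]; simp
    rw [Finset.sum_range_succ, pow_succ]
    rw [ih] at h
    have h2 : ((-1 : ℝ) ^ r) * ((-1) ^ r / (2 * (r : ℝ) + 1)) = 1 / (2 * (r : ℝ) + 1) := by
      rw [mul_div_assoc', h1]
    linear_combination h - h2

/-- Both sides change by the same amount under r → r + 2, so their difference is 2-periodic in r. It
is also bounded by 4/(2r+1), hence zero. -/
theorem realDigamma_sub_eq (r : ℕ) :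
    realDigamma ((2 * (r : ℝ) + 3) / 4) - realDigamma ((2 * (r : ℝ) + 1) / 4)
      = 4 * arctanMoment r := by
  let δ : ℕ → ℝ := fun r =>
    realDigamma ((2 * (r : ℝ) + 3) / 4) - realDigamma ((2 * (r : ℝ) + 1) / 4)
  have hrec : ∀ r, δ r - 4 * arctanMoment r = δ (r + 2) - 4 * arctanMoment (r + 2) := by
    intro r
    have h1 := realDigamma_add_one (x := (2 * (r : ℝ) + 3) / 4) (by positivity)
    have h2 := realDigamma_add_one (x := (2 * (r : ℝ) + 1) / 4) (by positivity)
    have h3 := arctanMoment_add_succ r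
    have h4 := arctanMoment_add_succ (r + 1)
    have e1 : (2 * ((r + 2 : ℕ) : ℝ) + 3) / 4 = (2 * (r : ℝ) + 3) / 4 + 1 := by push_cast; ring
    have e2 : (2 * ((r + 2 : ℕ) : ℝ) + 1) / 4 = (2 * (r : ℝ) + 1) / 4 + 1 := by push_cast; ring
    simp only [δ]
    rw [e1, e2, h1, h2]
    have e3 : 2 * ((r + 1 : ℕ) : ℝ) + 1 = 2 * r + 3 := by push_cast; ring
    rw [e3] at h4
    simp only [one_div_div]
    linear_combination 4 * h4 - 4 * h3
  have hiter : ∀ N r, δ r - 4 * arctanMoment r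
      = δ (r + 2 * N) - 4 * arctanMoment (r + 2 * N) := by
    intro N
    induction N with
    | zero => intro r; simp
    | succ N ih => intro r; rw [hrec r, ih (r + 2), show r + 2 + 2 * N = r + 2 * (N + 1) by ring]
  have hbd : ∀ r, |δ r - 4 * arctanMoment r| ≤ 4 / (2 * (r : ℝ) + 1) := by
    intro r
    have hp : (0 : ℝ) < (2 * (r : ℝ) + 1) / 4 := by positivity
    have h1 : 0 ≤ δ r := sub_nonneg.2 <| monotoneOn_realDigamma hp
      (show (0 : ℝ) < (2 * (r : ℝ) + 3) / 4 by positivity) (by linarith)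
    -- The arguments differ by 1/2, so monotonicity bounds δ by a full unit step of ψ, which is the
    -- reciprocal of the smaller argument.
    have h2 : δ r ≤ 4 / (2 * (r : ℝ) + 1) := by
      have h3 := realDigamma_add_one hp
      have h4 := monotoneOn_realDigamma (show (0 : ℝ) < (2 * (r : ℝ) + 3) / 4 by positivity)
        (show (0 : ℝ) < (2 * (r : ℝ) + 1) / 4 + 1 by positivity) (by linarith)
      rw [one_div_div] at h3
      simp only [δ]
      linarith
    have h5 := arctanMoment_nonneg r
    have h6 := arctanMoment_le r
    have h7 : 4 * (1 / (2 * (r : ℝ) + 1)) = 4 / (2 * (r : ℝ) + 1) := by ring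
    rw [abs_le]
    constructor <;> linarith
  have hlim : Filter.Tendsto (fun N : ℕ => 4 / (2 * ((r + 2 * N : ℕ) : ℝ) + 1)) Filter.atTop
      (nhds 0) := by
    refine Filter.Tendsto.const_div_atTop ?_ 4
    refine Filter.tendsto_atTop_mono (fun N => ?_) tendsto_natCast_atTop_atTop
    push_cast
    have : (0 : ℝ) ≤ r := Nat.cast_nonneg r
    have : (0 : ℝ) ≤ N := Nat.cast_nonneg N
    linarith
  have h0 : |δ r - 4 * arctanMoment r| ≤ 0 :=
    ge_of_tendsto hlim (Filter.Eventually.of_forall fun N => by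
      rw [hiter N r]; exact hbd _)
  exact sub_eq_zero.1 (abs_nonpos_iff.1 h0)

/-- The index r = k + n + 1 turns 2r + 3 into 2k + 2n + 5; the factor 4 in front of the moment
cancels against (2k+2m)² = 4(k+m)². -/
theorem theta1Term_eq (n m k : ℕ) :
    theta1Term n (2 * m) k
      = ((arctanMoment (k + n + 1) / ((k : ℝ) + m) ^ 2 : ℝ) : ℂ) := by
  have h := realDigamma_sub_eq (k + n + 1)
  have h1 := digamma_ofReal (x := (2 * ((k + n + 1 : ℕ) : ℝ) + 3) / 4) (by positivity)
  have h2 := digamma_ofReal (x := (2 * ((k + n + 1 : ℕ) : ℝ) + 1) / 4) (by positivity)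
  have e1 : (2 * (k : ℂ) + 2 * (n : ℂ) + 5) / 4
      = (((2 * ((k + n + 1 : ℕ) : ℝ) + 3) / 4 : ℝ) : ℂ) := by push_cast; ring
  have e2 : (2 * (k : ℂ) + 2 * (n : ℂ) + 3) / 4
      = (((2 * ((k + n + 1 : ℕ) : ℝ) + 1) / 4 : ℝ) : ℂ) := by push_cast; ring
  rw [theta1Term, e1, e2, h1, h2, ← Complex.ofReal_sub, h]
  push_cast
  have e3 : (2 * (k : ℂ) + 2 * (m : ℂ)) ^ 2 = 4 * ((k : ℂ) + m) ^ 2 := by ring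
  rw [e3, mul_div_mul_left _ _ (by norm_num)]

/-! ### The rational series ∑ 1/(K²(2K+2r+1)) -/

theorem realDigamma_add_natCast {x : ℝ} (hx : 0 < x) (n : ℕ) :
    realDigamma (x + n) = realDigamma x + ∑ j ∈ Finset.range n, 1 / (x + j) := by
  induction n with
  | zero => simp
  | succ n ih =>
    rw [Finset.sum_range_succ, ← add_assoc, ← ih, Nat.cast_succ, ← add_assoc,
      realDigamma_add_one (by positivity)]

/-- Partial sums are differences of digamma values: a fixed part ψ(r+3/2) - ψ(1), and a remainder
squeezed between 0 and (r+1)/(N+1). -/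
theorem hasSum_one_div_sub_one_div_add_half (r : ℕ) :
    HasSum (fun K : ℕ => 1 / ((K : ℝ) + 1) - 2 / (2 * (K : ℝ) + 2 * r + 3))
      (2 * ∑ j ∈ Finset.range (r + 1), 1 / (2 * (j : ℝ) + 1) - 2 * Real.log 2) := by
  rw [hasSum_iff_tendsto_nat_of_nonneg]
  swap
  · intro K
    rw [sub_nonneg, div_le_div_iff₀ (by positivity) (by positivity)]
    have : (0 : ℝ) ≤ r := Nat.cast_nonneg r
    linarith
  -- Only the difference ψ(1/2) - ψ(1) matters, so Euler's constant drops out.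
  have hhalf : realDigamma (1 / 2) = -2 * Real.log 2 + realDigamma 1 := by
    have h1 := digamma_ofReal (x := 1 / 2) (by norm_num)
    have h2 := digamma_ofReal (x := 1) (by norm_num)
    push_cast at h1 h2
    rw [Complex.digamma_one_half] at h1
    rw [Complex.digamma_one] at h2
    have h3 : Complex.log 2 = ((Real.log 2 : ℝ) : ℂ) := by
      rw [Complex.ofReal_log (by norm_num)]; norm_num
    rw [h3] at h1
    have h4 : -2 * Real.log 2 - Real.eulerMascheroniConstant = realDigamma (1 / 2) := by
      exact_mod_cast h1
    have h5 : -Real.eulerMascheroniConstant = realDigamma 1 := by exact_mod_cast h2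
    linarith
  have hA : realDigamma ((r : ℝ) + 3 / 2)
      = realDigamma (1 / 2) + 2 * ∑ j ∈ Finset.range (r + 1), 1 / (2 * (j : ℝ) + 1) := by
    have h := realDigamma_add_natCast (x := 1 / 2) (by norm_num) (r + 1)
    rw [show (1 / 2 : ℝ) + ((r + 1 : ℕ) : ℝ) = r + 3 / 2 by push_cast; ring] at h
    rw [h, Finset.mul_sum]
    congr 1
    refine Finset.sum_congr rfl fun j _ => ?_
    have : (2 * (j : ℝ) + 1) ≠ 0 := by positivity
    have : (1 / 2 + (j : ℝ)) ≠ 0 := by positivity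
    field_simp
    ring
  have hpart : ∀ N : ℕ, ∑ K ∈ Finset.range N,
      (1 / ((K : ℝ) + 1) - 2 / (2 * (K : ℝ) + 2 * r + 3))
      = (realDigamma ((r : ℝ) + 3 / 2) - realDigamma 1)
        - (realDigamma ((N : ℝ) + 1 + (r + 1 / 2)) - realDigamma ((N : ℝ) + 1)) := by
    intro N
    have h1 := realDigamma_add_natCast (x := 1) (by norm_num) N
    have h2 := realDigamma_add_natCast (x := (r : ℝ) + 3 / 2) (by positivity) N
    rw [Finset.sum_sub_distrib]
    have e1 : ∑ K ∈ Finset.range N, 1 / ((K : ℝ) + 1)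
        = ∑ K ∈ Finset.range N, 1 / (1 + (K : ℝ)) :=
      Finset.sum_congr rfl fun j _ => by rw [add_comm]
    have e2 : ∑ K ∈ Finset.range N, 2 / (2 * (K : ℝ) + 2 * r + 3)
        = ∑ K ∈ Finset.range N, 1 / ((r : ℝ) + 3 / 2 + K) :=
      Finset.sum_congr rfl fun j _ => by
        have : (2 * (j : ℝ) + 2 * r + 3) ≠ 0 := by positivity
        have : ((r : ℝ) + 3 / 2 + j) ≠ 0 := by positivity
        field_simp
        ring
    rw [e1, e2, show (N : ℝ) + 1 + (r + 1 / 2) = r + 3 / 2 + N by ring, add_comm (N : ℝ) 1]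
    linarith
  simp only [hpart]
  have hlim : Filter.Tendsto (fun N : ℕ =>
      realDigamma ((N : ℝ) + 1 + (r + 1 / 2)) - realDigamma ((N : ℝ) + 1)) Filter.atTop
      (nhds 0) := by
    have hb : Filter.Tendsto (fun N : ℕ => ((r : ℝ) + 1) / ((N : ℝ) + 1)) Filter.atTop (nhds 0) :=
      Filter.Tendsto.const_div_atTop
        (Filter.tendsto_atTop_add_const_right _ _ tendsto_natCast_atTop_atTop) _
    refine squeeze_zero (fun N => ?_) (fun N => ?_) hb
    · exact sub_nonneg.2 <| monotoneOn_realDigamma (show (0 : ℝ) < (N : ℝ) + 1 by positivity)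
        (show (0 : ℝ) < (N : ℝ) + 1 + (r + 1 / 2) by positivity)
        (le_add_of_nonneg_right (by positivity))
    · have h1 := realDigamma_add_natCast (x := (N : ℝ) + 1) (by positivity) (r + 1)
      have h2 := monotoneOn_realDigamma (show (0 : ℝ) < (N : ℝ) + 1 + (r + 1 / 2) by positivity)
        (show (0 : ℝ) < (N : ℝ) + 1 + ((r + 1 : ℕ) : ℝ) by positivity)
        (by push_cast; linarith)
      have h3 : ∑ j ∈ Finset.range (r + 1), 1 / ((N : ℝ) + 1 + j)
          ≤ ∑ j ∈ Finset.range (r + 1), 1 / ((N : ℝ) + 1) :=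
        Finset.sum_le_sum fun j _ => by
          apply one_div_le_one_div_of_le (by positivity)
          exact le_add_of_nonneg_right (by positivity)
      rw [Finset.sum_const, Finset.card_range, nsmul_eq_mul, mul_one_div] at h3
      push_cast at h3 h1 h2
      linarith
  have := (tendsto_const_nhds
    (x := realDigamma ((r : ℝ) + 3 / 2) - realDigamma 1)).sub hlim
  rw [hA, hhalf] at this
  rw [hA, hhalf]
  convert this using 2
  ring

theorem hasSum_one_div_succ_sq :
    HasSum (fun K : ℕ => 1 / ((K : ℝ) + 1) ^ 2) (Real.pi ^ 2 / 6) := by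
  have h := (hasSum_nat_add_iff' (f := fun n : ℕ => (1 : ℝ) / (n : ℝ) ^ 2) 1).2 hasSum_zeta_two
  simpa using h

/-- The value of `∑_{K ≥ 1} 1 / (K² (2K + 2r + 1))`. -/
noncomputable def mixedSum (r : ℕ) : ℝ :=
  Real.pi ^ 2 / 6 / (2 * (r : ℝ) + 1)
    - 2 / (2 * (r : ℝ) + 1) ^ 2
      * (2 * ∑ j ∈ Finset.range (r + 1), 1 / (2 * (j : ℝ) + 1) - 2 * Real.log 2)

/-- Partial fractions with x = K + 1 and a = 2r + 1: 1/(x²(2x+a)) = 1/(a x²) - (2/a²)(1/x -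
2/(2x+a)). -/
theorem hasSum_mixedSum (r : ℕ) :
    HasSum (fun K : ℕ => 1 / (((K : ℝ) + 1) ^ 2 * (2 * (K : ℝ) + 2 * r + 3))) (mixedSum r) := by
  have h := (hasSum_one_div_succ_sq.div_const (2 * (r : ℝ) + 1)).sub
    ((hasSum_one_div_sub_one_div_add_half r).mul_left (2 / (2 * (r : ℝ) + 1) ^ 2))
  refine h.congr_fun fun K => ?_
  have : (2 * (K : ℝ) + 2 * r + 3) ≠ 0 := by positivity
  have : (2 * (r : ℝ) + 1) ≠ 0 := by positivity
  have : (K : ℝ) + 1 ≠ 0 := by positivity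
  field_simp
  ring

/-! ### Moment sums, their recurrence, and the reduction of Θ₁ -/

/-- `∑_{K ≥ 1} c_{K + r} / K²` for the moments `c`. -/
noncomputable def momentSum (r : ℕ) : ℝ :=
  ∑' K : ℕ, arctanMoment (K + 1 + r) / ((K : ℝ) + 1) ^ 2

theorem hasSum_momentSum (r : ℕ) :
    HasSum (fun K : ℕ => arctanMoment (K + 1 + r) / ((K : ℝ) + 1) ^ 2) (momentSum r) := by
  refine Summable.hasSum (Summable.of_nonneg_of_le (fun K => ?_) (fun K => ?_)
    hasSum_one_div_succ_sq.summable)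
  · have := arctanMoment_nonneg (K + 1 + r)
    positivity
  · gcongr
    refine (arctanMoment_le _).trans ?_
    rw [div_le_one (by positivity)]
    exact le_add_of_nonneg_left (by positivity)

theorem momentSum_add_succ (r : ℕ) : momentSum r + momentSum (r + 1) = mixedSum r := by
  refine ((hasSum_momentSum r).add (hasSum_momentSum (r + 1))).unique
    ((hasSum_mixedSum r).congr_fun fun K => ?_)
  rw [← add_div, ← add_assoc, arctanMoment_add_succ, div_div, mul_comm]
  push_cast
  ring_nf

/-- After K = k + m the series has the terms c_{K+d+1}/K² with K > m, so it is the full moment sum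
without its first m terms. -/
theorem hasSum_theta1Term (m d : ℕ) :
    HasSum (fun k : ℕ => theta1Term (m + d) (2 * m) (k + 1))
      ((momentSum (d + 1) - ∑ k ∈ Finset.Icc 1 m,
        arctanMoment (k + (d + 1)) / (k : ℝ) ^ 2 : ℝ) : ℂ) := by
  have h := (hasSum_nat_add_iff' m).2 (hasSum_momentSum (d + 1))
  have e : ∑ i ∈ Finset.range m, arctanMoment (i + 1 + (d + 1)) / ((i : ℝ) + 1) ^ 2
      = ∑ k ∈ Finset.Icc 1 m, arctanMoment (k + (d + 1)) / (k : ℝ) ^ 2 := by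
    rw [← Finset.Ico_add_one_right_eq_Icc, Finset.sum_Ico_eq_sum_range]
    refine Finset.sum_congr (by simp) fun i _ => ?_
    rw [add_comm 1 i]
    push_cast
    rfl
  rw [e] at h
  refine (Complex.hasSum_ofReal.2 h).congr_fun fun k => ?_
  rw [theta1Term_eq]
  congr 1
  push_cast
  congr 2 <;> ring

/-! ### Polylogarithm series on the closed disc and their special values -/

/-- The polylogarithm series `∑_{k ≥ 1} z^k / k^s`. -/
noncomputable def polylogSeries (s : ℕ) (z : ℂ) : ℂ := ∑' k : ℕ, z ^ (k + 1) / ((k : ℂ) + 1) ^ s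

theorem norm_polylog_term_le {s : ℕ} (hs : 2 ≤ s) {z : ℂ} (hz : ‖z‖ ≤ 1) (k : ℕ) :
    ‖z ^ (k + 1) / ((k : ℂ) + 1) ^ s‖ ≤ 1 / ((k : ℝ) + 1) ^ 2 := by
  have h : ‖(k : ℂ) + 1‖ = (k : ℝ) + 1 := by
    rw [← Nat.cast_succ, Complex.norm_natCast, Nat.cast_succ]
  rw [norm_div, norm_pow, norm_pow, h]
  refine div_le_div₀ zero_le_one (pow_le_one₀ (norm_nonneg _) hz) (by positivity) ?_
  exact pow_le_pow_right₀ (by simp) hs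

theorem hasSum_polylogSeries {s : ℕ} (hs : 2 ≤ s) {z : ℂ} (hz : ‖z‖ ≤ 1) :
    HasSum (fun k : ℕ => z ^ (k + 1) / ((k : ℂ) + 1) ^ s) (polylogSeries s z) :=
  (Summable.of_norm_bounded hasSum_one_div_succ_sq.summable
    fun k => norm_polylog_term_le hs hz k).hasSum

theorem continuousOn_polylogSeries {s : ℕ} (hs : 2 ≤ s) :
    ContinuousOn (polylogSeries s) (Metric.closedBall 0 1) :=
  continuousOn_tsum (fun k => by fun_prop) hasSum_one_div_succ_sq.summable
    fun k z hz => norm_polylog_term_le hs (by simpa using hz) k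

theorem polylogSeries_zero (s : ℕ) : polylogSeries s 0 = 0 := by
  simp [polylogSeries]

theorem polylogSeries_conj (s : ℕ) (z : ℂ) :
    polylogSeries s (starRingEnd ℂ z) = starRingEnd ℂ (polylogSeries s z) := by
  simp [polylogSeries, Complex.conj_tsum]

theorem hasDerivAt_polylogSeries_succ {s : ℕ} (hs : 1 ≤ s) {z : ℂ} (hz : ‖z‖ < 1) (hz0 : z ≠ 0) :
    HasDerivAt (polylogSeries (s + 1)) (polylogSeries s z / z) z := by
  have hd : ∀ k : ℕ, DifferentiableOn ℂ (fun z : ℂ => z ^ (k + 1) / ((k : ℂ) + 1) ^ (s + 1))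
      (Metric.ball 0 1) := fun k => by fun_prop
  have hb : ∀ (k : ℕ) (w : ℂ), w ∈ Metric.ball (0 : ℂ) 1 →
      ‖w ^ (k + 1) / ((k : ℂ) + 1) ^ (s + 1)‖ ≤ 1 / ((k : ℝ) + 1) ^ 2 := fun k w hw =>
    norm_polylog_term_le (by omega) (by simpa using (Metric.mem_ball.1 hw).le) k
  have hm : z ∈ Metric.ball (0 : ℂ) 1 := by simpa using hz
  have hu := hasSum_one_div_succ_sq.summable
  have h1 := Complex.hasSum_deriv_of_summable_norm hu hd Metric.isOpen_ball hb hm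
  have h2 := (Complex.differentiableOn_tsum_of_summable_norm hu hd Metric.isOpen_ball hb
    ).differentiableAt (Metric.isOpen_ball.mem_nhds hm)
  have h3 := h2.hasDerivAt
  rw [← h1.tsum_eq] at h3
  refine h3.congr_deriv ?_
  rw [polylogSeries, ← tsum_div_const]
  refine tsum_congr fun k => ?_
  have hk : (k : ℂ) + 1 ≠ 0 := by exact_mod_cast k.succ_ne_zero
  simp only [deriv_div_const, deriv_pow_field, Nat.cast_succ, Nat.add_sub_cancel]
  field_simp
  ring

theorem polylogSeries_one {z : ℂ} (hz : ‖z‖ < 1) : polylogSeries 1 z = -Complex.log (1 - z) := by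
  have h := (hasSum_nat_add_iff' 1).2 (Complex.hasSum_taylorSeries_neg_log hz)
  simp only [Nat.cast_add, Nat.cast_one, Finset.range_one, Finset.sum_singleton, Nat.cast_zero,
    div_zero, sub_zero] at h
  simpa [polylogSeries] using h.tsum_eq

theorem hasDerivAt_dilogSeries {z : ℂ} (hz : ‖z‖ < 1) (hz0 : z ≠ 0) :
    HasDerivAt (polylogSeries 2) (-Complex.log (1 - z) / z) z := by
  simpa [polylogSeries_one hz] using hasDerivAt_polylogSeries_succ le_rfl hz hz0

theorem trilog_eq_polylogSeries {z : ℂ} (hz : ‖z‖ < 1) : trilog z = polylogSeries 3 z :=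
  (hasSum_trilog hz).unique (hasSum_polylogSeries (by norm_num) hz.le)

theorem dilogSeries_one : polylogSeries 2 1 = ((Real.pi ^ 2 / 6 : ℝ) : ℂ) := by
  refine (hasSum_polylogSeries le_rfl (by simp)).unique ?_
  refine (Complex.hasSum_ofReal.2 hasSum_one_div_succ_sq).congr_fun fun k => ?_
  push_cast
  simp

theorem trilogSeries_one_im : (polylogSeries 3 1).im = 0 := by
  have h := polylogSeries_conj 3 1
  rw [map_one] at h
  exact Complex.conj_eq_iff_im.1 h.symm

/-- Splitting the polylogarithm series at `i` into its imaginary and real parts. -/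
theorem polylogSeries_I_im {s : ℕ} (hs : 2 ≤ s) :
    HasSum (fun k : ℕ => (-1 : ℝ) ^ k / (2 * (k : ℝ) + 1) ^ s) (polylogSeries s Complex.I).im := by
  have h := Complex.hasSum_im (hasSum_polylogSeries hs (z := Complex.I) (by simp))
  have hinj : Function.Injective fun k : ℕ => 2 * k := fun a b h => by simpa using h
  have h2 := (hinj.hasSum_iff (f := fun k : ℕ =>
    (Complex.I ^ (k + 1) / ((k : ℂ) + 1) ^ s).im) ?_).2 h
  · refine h2.congr_fun fun k => ?_
    have : Complex.I ^ (2 * k + 1) / (((2 * k : ℕ) : ℂ) + 1) ^ s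
        = (((-1 : ℝ) ^ k / (2 * (k : ℝ) + 1) ^ s : ℝ) : ℂ) * Complex.I := by
      rw [pow_succ, pow_mul, Complex.I_sq]
      push_cast
      ring
    simp only [Function.comp_apply, this, Complex.im_ofReal_mul, Complex.I_im, mul_one]
  · intro k hk
    obtain ⟨j, rfl | rfl⟩ := k.even_or_odd'
    · exact absurd ⟨j, rfl⟩ hk
    · have : Complex.I ^ (2 * j + 1 + 1) / (((2 * j + 1 : ℕ) : ℂ) + 1) ^ s
          = (((-1 : ℝ) ^ (j + 1) / (2 * (j : ℝ) + 2) ^ s : ℝ) : ℂ) := by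
        rw [show 2 * j + 1 + 1 = 2 * (j + 1) by ring, pow_mul, Complex.I_sq]
        push_cast
        ring
      rw [this, Complex.ofReal_im]

theorem dilogSeries_I_im : (polylogSeries 2 Complex.I).im = catalanG :=
  ((polylogSeries_I_im le_rfl).tsum_eq).symm

theorem trilogSeries_I_im : (polylogSeries 3 Complex.I).im = Real.pi ^ 3 / 32 := by
  refine (polylogSeries_I_im (by norm_num)).unique ?_
  have hinj : Function.Injective fun k : ℕ => 2 * k + 1 := fun a b h => by simpa using h
  have h2 := (hinj.hasSum_iff ?_).2 hasSum_L_function_mod_four_eval_three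
  · refine h2.congr_fun fun k => ?_
    have : Real.sin (Real.pi * ((2 * k + 1 : ℕ) : ℝ) / 2) = (-1) ^ k := by
      rw [show Real.pi * ((2 * k + 1 : ℕ) : ℝ) / 2 = Real.pi / 2 + k * Real.pi by push_cast; ring,
        Real.sin_add_nat_mul_pi, Real.sin_pi_div_two, mul_one]
    simp only [Function.comp_apply, this]
    push_cast
    ring
  · intro k hk
    obtain ⟨j, rfl | rfl⟩ := k.even_or_odd'
    · rw [show Real.pi * ((2 * j : ℕ) : ℝ) / 2 = j * Real.pi by push_cast; ring,
        Real.sin_nat_mul_pi, mul_zero]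
    · exact absurd ⟨j, rfl⟩ hk

/-- Adding the series at 1 and -1 cancels the odd powers and leaves half of the series at 1. -/
theorem dilogSeries_neg_one : polylogSeries 2 (-1) = ((-(Real.pi ^ 2 / 12) : ℝ) : ℂ) := by
  have hs1 := hasSum_polylogSeries (s := 2) le_rfl (z := 1) (by simp)
  have hs2 := hasSum_polylogSeries (s := 2) le_rfl (z := -1) (by simp)
  have h := hs1.add hs2
  have hinj : Function.Injective fun k : ℕ => 2 * k + 1 := fun a b h => by simpa using h
  have h2 := (hinj.hasSum_iff (f := fun k : ℕ =>
    (1 : ℂ) ^ (k + 1) / ((k : ℂ) + 1) ^ 2 + (-1) ^ (k + 1) / ((k : ℂ) + 1) ^ 2) ?_).2 h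
  · have h3 : HasSum (fun k : ℕ => (1 : ℂ) ^ (k + 1) / ((k : ℂ) + 1) ^ 2 * (1 / 2))
        (polylogSeries 2 1 + polylogSeries 2 (-1)) := by
      refine h2.congr_fun fun k => ?_
      have hk : (k : ℂ) + 1 ≠ 0 := by exact_mod_cast k.succ_ne_zero
      simp only [Function.comp_apply, one_pow,
        show 2 * k + 1 + 1 = 2 * (k + 1) by ring, pow_mul, neg_one_sq, one_pow]
      push_cast
      rw [show 2 * (k : ℂ) + 1 + 1 = 2 * (k + 1) by ring]
      field_simp
      norm_num
    have h4 := h3.unique (hs1.mul_right (1 / 2))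
    rw [dilogSeries_one] at h4
    push_cast at h4 ⊢
    linear_combination h4
  · intro k hk
    obtain ⟨j, rfl | rfl⟩ := k.even_or_odd'
    · rw [pow_succ (-1 : ℂ), pow_mul]
      simp only [one_pow, neg_one_sq]
      ring
    · exact absurd ⟨j, rfl⟩ hk

/-- Only even powers of i are real, and they form a quarter of the series at -1. -/
theorem dilogSeries_I_re : (polylogSeries 2 Complex.I).re = -(Real.pi ^ 2 / 48) := by
  have h := Complex.hasSum_re (hasSum_polylogSeries (s := 2) le_rfl (z := Complex.I) (by simp))
  have hinj : Function.Injective fun k : ℕ => 2 * k + 1 := fun a b h => by simpa using h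
  have h2 := (hinj.hasSum_iff (f := fun k : ℕ =>
    (Complex.I ^ (k + 1) / ((k : ℂ) + 1) ^ 2).re) ?_).2 h
  · have h3 := Complex.hasSum_re
      ((hasSum_polylogSeries (s := 2) le_rfl (z := -1) (by simp)).mul_right (1 / 4))
    have h4 := (h2.congr_fun fun k => ?_).unique h3
    · rw [h4, dilogSeries_neg_one, show (1 / 4 : ℂ) = ((1 / 4 : ℝ) : ℂ) by push_cast; rfl,
        ← Complex.ofReal_mul, Complex.ofReal_re]
      ring
    · have hk : (k : ℂ) + 1 ≠ 0 := by exact_mod_cast k.succ_ne_zero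
      simp only [Function.comp_apply]
      congr 1
      rw [show 2 * k + 1 + 1 = 2 * (k + 1) by ring, pow_mul, Complex.I_sq]
      push_cast
      rw [show 2 * (k : ℂ) + 1 + 1 = 2 * (k + 1) by ring]
      field_simp
      norm_num
  · intro k hk
    obtain ⟨j, rfl | rfl⟩ := k.even_or_odd'
    · have : Complex.I ^ (2 * j + 1) / (((2 * j : ℕ) : ℂ) + 1) ^ 2
          = (((-1 : ℝ) ^ j / (2 * (j : ℝ) + 1) ^ 2 : ℝ) : ℂ) * Complex.I := by
        rw [pow_succ, pow_mul, Complex.I_sq]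
        push_cast
        ring
      simp only [this, Complex.re_ofReal_mul, Complex.I_re, mul_zero]
    · exact absurd ⟨j, rfl⟩ hk

/-- The sum `∑_{K ≥ 1} c_K / K²` as an integral of the dilogarithm. -/
theorem momentSum_zero_eq_integral :
    ∫ t in (0 : ℝ)..1, (polylogSeries 2 ((t : ℂ) ^ 2)).re / (1 + t ^ 2) = momentSum 0 := by
  let F : ℕ → ℝ → ℝ := fun K t => t ^ (2 * (K + 1)) / (1 + t ^ 2) / ((K : ℝ) + 1) ^ 2
  have hi : ∀ K, ∫ t in Set.Ioc (0 : ℝ) 1, F K t = arctanMoment (K + 1 + 0) / ((K : ℝ) + 1) ^ 2 := by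
    intro K
    rw [arctanMoment, intervalIntegral.integral_of_le zero_le_one]
    exact MeasureTheory.integral_div _ _
  have hI : ∀ K, MeasureTheory.Integrable (F K)
      (MeasureTheory.volume.restrict (Set.Ioc (0 : ℝ) 1)) := by
    intro K
    have h := ((continuous_pow_div_one_add_sq (2 * (K + 1))).div_const
      (((K : ℝ) + 1) ^ 2)).intervalIntegrable (μ := MeasureTheory.volume) 0 1
    rwa [intervalIntegrable_iff_integrableOn_Ioc_of_le zero_le_one] at h
  have hn : ∀ K, ∫ t in Set.Ioc (0 : ℝ) 1, ‖F K t‖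
      = arctanMoment (K + 1 + 0) / ((K : ℝ) + 1) ^ 2 := by
    intro K
    rw [← hi K]
    refine MeasureTheory.setIntegral_congr_fun measurableSet_Ioc fun t ht => ?_
    have : 0 < t := ht.1
    exact Real.norm_of_nonneg (by positivity)
  have key := MeasureTheory.hasSum_integral_of_summable_integral_norm hI (by
    simp only [hn]; exact (hasSum_momentSum 0).summable)
  simp only [hi] at key
  rw [(hasSum_momentSum 0).unique key, intervalIntegral.integral_of_le zero_le_one]
  refine MeasureTheory.setIntegral_congr_fun measurableSet_Ioc fun t ht => ?_
  have ht1 : ‖(t : ℂ) ^ 2‖ ≤ 1 := by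
    rw [norm_pow, Complex.norm_real, Real.norm_of_nonneg ht.1.le]
    exact pow_le_one₀ ht.1.le ht.2
  have h := (Complex.hasSum_re (hasSum_polylogSeries (s := 2) le_rfl ht1)).div_const (1 + t ^ 2)
  refine (h.congr_fun fun K => ?_).tsum_eq.symm
  have : ((t : ℂ) ^ 2) ^ (K + 1) / ((K : ℂ) + 1) ^ 2
      = ((t ^ (2 * (K + 1)) / ((K : ℝ) + 1) ^ 2 : ℝ) : ℂ) := by
    push_cast
    rw [pow_mul]
  rw [this, Complex.ofReal_re]
  simp only [F]
  ring

/-! ### Li₂ and Li₃ on the cut plane -/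

/-- The plane cut along `[1, ∞)`, as in `differentiableOn_trilog`. -/
def cutPlane : Set ℂ := {z : ℂ | ∀ t : ℝ, 1 ≤ t → z ≠ (t : ℂ)}

theorem mem_cutPlane_iff {z : ℂ} : z ∈ cutPlane ↔ 1 - z ∈ Complex.slitPlane := by
  rw [Complex.mem_slitPlane_iff_not_le_zero, Complex.le_def]
  simp only [cutPlane, Set.mem_ofPred_eq, Complex.sub_re, Complex.one_re, Complex.zero_re,
    Complex.sub_im, Complex.one_im, Complex.zero_im]
  constructor
  · rintro h ⟨h1, h2⟩
    exact h z.re (by linarith) (Complex.ext rfl (by simp; linarith))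
  · rintro h t ht rfl
    exact h ⟨by simpa using ht, by simp⟩

theorem isOpen_cutPlane : IsOpen cutPlane := by
  have : cutPlane = (fun z : ℂ => 1 - z) ⁻¹' Complex.slitPlane := by
    ext z; exact mem_cutPlane_iff
  rw [this]
  exact Complex.isOpen_slitPlane.preimage (by fun_prop)

theorem isPreconnected_cutPlane : IsPreconnected cutPlane := by
  have h : StarConvex ℝ (0 : ℂ) cutPlane := by
    rw [starConvex_zero_iff]
    intro z hz a ha ha1 t ht hzt
    rcases ha.eq_or_lt with rfl | ha0
    · have : (0 : ℝ) = t := by exact_mod_cast (by simpa using hzt : (0 : ℂ) = t)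
      linarith
    · refine hz (t / a) ?_ ?_
      · rw [le_div_iff₀ ha0]
        linarith
      · have : (a : ℂ) ≠ 0 := by exact_mod_cast ha0.ne'
        rw [Complex.real_smul] at hzt
        push_cast
        rw [eq_div_iff this, mul_comm, hzt]
  exact (h.isPathConnected (mem_cutPlane_iff.2 (by simp))).isConnected.isPreconnected

theorem ball_subset_cutPlane : Metric.ball (0 : ℂ) 1 ⊆ cutPlane := by
  rintro z hz t ht rfl
  rw [mem_ball_zero_iff, Complex.norm_real, Real.norm_eq_abs, abs_lt] at hz
  linarith [hz.2]

theorem mem_cutPlane_of_im_ne_zero {z : ℂ} (hz : z.im ≠ 0) : z ∈ cutPlane := by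
  rintro t - rfl
  exact hz (Complex.ofReal_im t)

/-- The dilogarithm on the cut plane, as `z Li₃'(z)`. -/
noncomputable def dilog (z : ℂ) : ℂ := z * deriv trilog z

theorem analyticOnNhd_trilog : AnalyticOnNhd ℂ trilog cutPlane :=
  DifferentiableOn.analyticOnNhd differentiableOn_trilog isOpen_cutPlane

theorem analyticOnNhd_dilog : AnalyticOnNhd ℂ dilog cutPlane :=
  analyticOnNhd_id.mul analyticOnNhd_trilog.deriv

theorem hasDerivAt_trilog {z : ℂ} (hz : z ∈ cutPlane) (hz0 : z ≠ 0) :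
    HasDerivAt trilog (dilog z / z) z := by
  rw [dilog, mul_div_cancel_left₀ _ hz0]
  exact (analyticOnNhd_trilog z hz).differentiableAt.hasDerivAt

theorem dilog_eq_polylogSeries {z : ℂ} (hz : ‖z‖ < 1) : dilog z = polylogSeries 2 z := by
  rcases eq_or_ne z 0 with rfl | hz0
  · simp [dilog, polylogSeries_zero]
  have h1 : trilog =ᶠ[nhds z] polylogSeries 3 := by
    filter_upwards [Metric.isOpen_ball.mem_nhds (mem_ball_zero_iff.2 hz)] with w hw
    exact trilog_eq_polylogSeries (mem_ball_zero_iff.1 hw)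
  rw [dilog, h1.deriv_eq, (hasDerivAt_polylogSeries_succ one_le_two hz hz0).deriv,
    mul_div_cancel₀ _ hz0]

/-- Identity theorem: z Li₂'(z) and -log(1-z) are analytic on the connected cut plane and agree near
0 by the power series. -/
theorem hasDerivAt_dilog {z : ℂ} (hz : z ∈ cutPlane) (hz0 : z ≠ 0) :
    HasDerivAt dilog (-Complex.log (1 - z) / z) z := by
  have hlog : AnalyticOnNhd ℂ (fun z : ℂ => -Complex.log (1 - z)) cutPlane := fun w hw =>
    ((analyticAt_const.sub analyticAt_id).clog (mem_cutPlane_iff.1 hw)).neg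
  have hD : AnalyticOnNhd ℂ (fun z : ℂ => z * deriv dilog z) cutPlane :=
    analyticOnNhd_id.mul analyticOnNhd_dilog.deriv
  have h0 : (0 : ℂ) ∈ cutPlane := ball_subset_cutPlane (by simp)
  have heq : (fun z : ℂ => z * deriv dilog z) =ᶠ[nhds 0] fun z => -Complex.log (1 - z) := by
    filter_upwards [Metric.ball_mem_nhds (0 : ℂ) one_pos] with w hw
    rcases eq_or_ne w 0 with rfl | hw0
    · simp
    have hw1 : ‖w‖ < 1 := mem_ball_zero_iff.1 hw
    have h1 : dilog =ᶠ[nhds w] polylogSeries 2 := by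
      filter_upwards [Metric.isOpen_ball.mem_nhds hw] with v hv
      exact dilog_eq_polylogSeries (mem_ball_zero_iff.1 hv)
    rw [h1.deriv_eq, (hasDerivAt_dilogSeries hw1 hw0).deriv, mul_div_cancel₀ _ hw0]
  have h : z * deriv dilog z = -Complex.log (1 - z) :=
    hD.eqOn_of_preconnected_of_eventuallyEq hlog isPreconnected_cutPlane h0 heq hz
  have h2 : -Complex.log (1 - z) / z = deriv dilog z := by
    rw [← h]
    exact mul_div_cancel_left₀ _ hz0
  rw [h2]
  exact (analyticOnNhd_dilog z hz).differentiableAt.hasDerivAt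

/-- Two limits from inside the disc coincide. This reaches the unit circle, where the inversion
formulas are normalised. -/
theorem eq_polylogSeries_of_norm_le_one {f : ℂ → ℂ} {s : ℕ} (hs : 2 ≤ s)
    (hf : ∀ z, ‖z‖ < 1 → f z = polylogSeries s z) {z : ℂ} (hz : ‖z‖ ≤ 1)
    (hc : ContinuousAt f z) : f z = polylogSeries s z := by
  have hcl : z ∈ closure (Metric.ball (0 : ℂ) 1) := by
    rw [closure_ball _ one_ne_zero]
    simpa using hz
  have hne : (nhdsWithin z (Metric.ball 0 1)).NeBot := mem_closure_iff_nhdsWithin_neBot.1 hcl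
  have h1 : Filter.Tendsto f (nhdsWithin z (Metric.ball 0 1)) (nhds (f z)) :=
    hc.continuousWithinAt
  have h2 : Filter.Tendsto (polylogSeries s) (nhdsWithin z (Metric.ball 0 1))
      (nhds (polylogSeries s z)) :=
    ((continuousOn_polylogSeries hs) z (by simpa using hz)).mono Metric.ball_subset_closedBall
  refine tendsto_nhds_unique h1 (h2.congr' ?_)
  filter_upwards [self_mem_nhdsWithin] with w hw
  exact (hf w (mem_ball_zero_iff.1 hw)).symm

theorem trilog_eq_polylogSeries' {z : ℂ} (hz : ‖z‖ ≤ 1) (hc : z ∈ cutPlane) :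
    trilog z = polylogSeries 3 z :=
  eq_polylogSeries_of_norm_le_one (by norm_num) (fun _ h => trilog_eq_polylogSeries h) hz
    (analyticOnNhd_trilog z hc).continuousAt

theorem dilog_eq_polylogSeries' {z : ℂ} (hz : ‖z‖ ≤ 1) (hc : z ∈ cutPlane) :
    dilog z = polylogSeries 2 z :=
  eq_polylogSeries_of_norm_le_one le_rfl (fun _ h => dilog_eq_polylogSeries h) hz
    (analyticOnNhd_dilog z hc).continuousAt

/-! ### Inversion formulas in the upper half-plane -/

/-- This is log(1-z) - log(-z), with log(-z) = log z - πi for z above the real axis. The two factors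
of (1-z)(-z)⁻¹ have arguments of opposite sign, so no multiple of 2πi appears. -/
theorem log_one_sub_inv {z : ℂ} (hz : 0 < z.im) :
    Complex.log (1 - z⁻¹) = Complex.log (1 - z) - (Complex.log z - Real.pi * Complex.I) := by
  have hz0 : z ≠ 0 := by rintro rfl; simp at hz
  have h1z : 1 - z ≠ 0 := fun h => by
    have := congrArg Complex.im h
    simp at this
    linarith
  have hneg : (-z).im < 0 := by simpa using hz
  have hn0 : -z ≠ 0 := neg_ne_zero.2 hz0
  have e : 1 - z⁻¹ = (1 - z) * (-z)⁻¹ := by field_simp; ring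
  have a1 : Complex.arg (1 - z) < 0 := Complex.arg_neg_iff.2 (by simpa using hz)
  have a2 := Complex.neg_pi_lt_arg (1 - z)
  have hi : 0 < ((-z)⁻¹).im := by
    rw [Complex.inv_im]
    exact div_pos (by linarith) (Complex.normSq_pos.2 hn0)
  have a3 : 0 ≤ Complex.arg (-z)⁻¹ := Complex.arg_nonneg_iff.2 hi.le
  have a4 := Complex.arg_le_pi (-z)⁻¹
  have hl1 : Complex.log (-z)⁻¹ = -Complex.log (-z) := Complex.log_inv _ (by
    have : Complex.arg (-z) < 0 := Complex.arg_neg_iff.2 hneg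
    linarith [Real.pi_pos])
  have hl2 : Complex.log (-z) = Complex.log z - Real.pi * Complex.I := by
    rw [Complex.log, Complex.log, Complex.arg_neg_eq_arg_sub_pi_of_im_pos hz, norm_neg]
    push_cast
    ring
  rw [e, Complex.log_mul h1z (inv_ne_zero hn0) ⟨by linarith, by linarith⟩, hl1, hl2]
  ring

theorem convex_upperHalfPlane : Convex ℝ {z : ℂ | 0 < z.im} := convex_halfSpace_im_gt 0

theorem isOpen_upperHalfPlane : IsOpen {z : ℂ | 0 < z.im} :=
  isOpen_lt continuous_const Complex.continuous_im

theorem eq_of_hasDerivAt_zero_upperHalfPlane {f : ℂ → ℂ}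
    (hf : ∀ z : ℂ, 0 < z.im → HasDerivAt f 0 z) {z w : ℂ} (hz : 0 < z.im) (hw : 0 < w.im) :
    f z = f w :=
  isOpen_upperHalfPlane.is_const_of_deriv_eq_zero convex_upperHalfPlane.isPreconnected
    (fun x hx => (hf x hx).differentiableAt.differentiableWithinAt)
    (fun x hx => (hf x hx).deriv) hz hw

theorem inv_im_neg {z : ℂ} (hz : 0 < z.im) : (z⁻¹).im < 0 := by
  have hz0 : z ≠ 0 := by rintro rfl; simp at hz
  rw [Complex.inv_im]
  exact div_neg_of_neg_of_pos (by linarith) (Complex.normSq_pos.2 hz0)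

theorem hasDerivAt_log_sub_pi {z : ℂ} (hz : 0 < z.im) :
    HasDerivAt (fun z => Complex.log z - Real.pi * Complex.I) z⁻¹ z :=
  (Complex.hasDerivAt_log (Complex.mem_slitPlane_iff.2 (Or.inr hz.ne'))).sub_const _

/-- Inversion formula for the dilogarithm. -/
theorem dilog_add_dilog_inv {z : ℂ} (hz : 0 < z.im) :
    dilog z + dilog z⁻¹ + (Complex.log z - Real.pi * Complex.I) ^ 2 / 2
      = -((Real.pi : ℂ) ^ 2 / 6) := by
  -- The left side is constant on the half-plane; evaluating at i fixes the constant, because i⁻¹ is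
  -- the conjugate of i and only Re Li₂(i) enters.
  rw [eq_of_hasDerivAt_zero_upperHalfPlane (w := Complex.I)
    (f := fun z => dilog z + dilog z⁻¹ + (Complex.log z - Real.pi * Complex.I) ^ 2 / 2)
    ?_ hz (by simp)]
  · have h1 := dilog_eq_polylogSeries' (z := Complex.I) (by simp)
      (mem_cutPlane_of_im_ne_zero (by simp))
    have h2 := dilog_eq_polylogSeries' (z := Complex.I⁻¹) (by simp)
      (mem_cutPlane_of_im_ne_zero (by simp))
    have h3 : polylogSeries 2 Complex.I⁻¹ = starRingEnd ℂ (polylogSeries 2 Complex.I) := by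
      rw [← polylogSeries_conj, Complex.conj_I, Complex.inv_I]
    rw [h1, h2, h3, Complex.add_conj, dilogSeries_I_re, Complex.log_I]
    push_cast
    linear_combination (Real.pi : ℂ) ^ 2 / 8 * Complex.I_sq
  · intro z hz
    have hz0 : z ≠ 0 := by rintro rfl; simp at hz
    have h1 := hasDerivAt_dilog (mem_cutPlane_of_im_ne_zero hz.ne') hz0
    have h2 := (hasDerivAt_dilog (mem_cutPlane_of_im_ne_zero (inv_im_neg hz).ne)
      (inv_ne_zero hz0)).comp z (hasDerivAt_inv hz0)
    have h3 := ((hasDerivAt_log_sub_pi hz).pow 2).div_const 2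
    refine ((h1.add h2).add h3).congr_deriv ?_
    rw [log_one_sub_inv hz]
    field_simp
    push_cast
    ring

/-- Inversion formula for the trilogarithm. -/
theorem trilog_sub_trilog_inv {z : ℂ} (hz : 0 < z.im) :
    trilog z - trilog z⁻¹ + (Complex.log z - Real.pi * Complex.I) ^ 3 / 6
      + (Real.pi : ℂ) ^ 2 / 6 * (Complex.log z - Real.pi * Complex.I) = 0 := by
  rw [eq_of_hasDerivAt_zero_upperHalfPlane (w := Complex.I)
    (f := fun z => trilog z - trilog z⁻¹ + (Complex.log z - Real.pi * Complex.I) ^ 3 / 6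
      + (Real.pi : ℂ) ^ 2 / 6 * (Complex.log z - Real.pi * Complex.I))
    ?_ hz (by simp)]
  · have h1 := trilog_eq_polylogSeries' (z := Complex.I) (by simp)
      (mem_cutPlane_of_im_ne_zero (by simp))
    have h2 := trilog_eq_polylogSeries' (z := Complex.I⁻¹) (by simp)
      (mem_cutPlane_of_im_ne_zero (by simp))
    have h3 : polylogSeries 3 Complex.I⁻¹ = starRingEnd ℂ (polylogSeries 3 Complex.I) := by
      rw [← polylogSeries_conj, Complex.conj_I, Complex.inv_I]
    rw [h1, h2, h3, Complex.sub_conj, trilogSeries_I_im, Complex.log_I]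
    push_cast
    linear_combination (-(Real.pi : ℂ) ^ 3 / 48 * Complex.I) * Complex.I_sq
  · intro z hz
    have hz0 : z ≠ 0 := by rintro rfl; simp at hz
    have h1 := hasDerivAt_trilog (mem_cutPlane_of_im_ne_zero hz.ne') hz0
    have h2 := (hasDerivAt_trilog (mem_cutPlane_of_im_ne_zero (inv_im_neg hz).ne)
      (inv_ne_zero hz0)).comp z (hasDerivAt_inv hz0)
    have h3 := ((hasDerivAt_log_sub_pi hz).pow 3).div_const 6
    have h4 := (hasDerivAt_log_sub_pi hz).const_mul ((Real.pi : ℂ) ^ 2 / 6)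
    refine (((h1.sub h2).add h3).add h4).congr_deriv ?_
    -- The derivative of the Li₃ expression is the Li₂ inversion formula divided by z.
    have h := dilog_add_dilog_inv hz
    have e : dilog z = -dilog z⁻¹ - (Complex.log z - Real.pi * Complex.I) ^ 2 / 2
        - (Real.pi : ℂ) ^ 2 / 6 := by linear_combination h
    rw [e]
    field_simp
    push_cast
    ring

/-! ### Primitives of log² v(u) / u along paths in the unit disc -/

section PathPrimitives

open Filter Topology

/-- `log (1 + i u)` for real `u`, in Cartesian form. -/
noncomputable def logOneAddI (u : ℝ) : ℂ :=
  ((Real.log (1 + u ^ 2) / 2 : ℝ) : ℂ) + (Real.arctan u : ℂ) * Complex.I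

theorem one_add_I_mul_ne_zero (u : ℝ) : 1 + Complex.I * u ≠ 0 := fun h => by
  have := congrArg Complex.re h
  simp at this

theorem exp_logOneAddI (u : ℝ) : Complex.exp (logOneAddI u) = 1 + Complex.I * u := by
  have hp : (0 : ℝ) < 1 + u ^ 2 := by positivity
  have hs : (Real.sqrt (1 + u ^ 2) : ℂ) ≠ 0 := by
    exact_mod_cast (Real.sqrt_pos.2 hp).ne'
  rw [logOneAddI, Complex.exp_add, Complex.exp_mul_I, ← Complex.ofReal_exp, ← Complex.ofReal_cos,
    ← Complex.ofReal_sin, Real.cos_arctan, Real.sin_arctan, ← Real.log_sqrt hp.le,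
    Real.exp_log (Real.sqrt_pos.2 hp)]
  push_cast
  field_simp

theorem logOneAddI_im (u : ℝ) : (logOneAddI u).im = Real.arctan u := by
  rw [logOneAddI, Complex.add_im, Complex.ofReal_im, Complex.im_ofReal_mul, Complex.I_im]
  ring

theorem logOneAddI_re (u : ℝ) : (logOneAddI u).re = Real.log (1 + u ^ 2) / 2 := by
  rw [logOneAddI, Complex.add_re, Complex.ofReal_re, Complex.re_ofReal_mul, Complex.I_re]
  ring

theorem log_one_add_I_mul (u : ℝ) : Complex.log (1 + Complex.I * u) = logOneAddI u := by
  rw [← exp_logOneAddI, Complex.log_exp]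
  · rw [logOneAddI_im]
    linarith [Real.neg_pi_div_two_lt_arctan u, Real.pi_pos]
  · rw [logOneAddI_im]
    linarith [Real.arctan_lt_pi_div_two u, Real.pi_pos]

theorem hasDerivAt_logOneAddI (u : ℝ) :
    HasDerivAt logOneAddI (Complex.I / (1 + Complex.I * u)) u := by
  have h1 : HasDerivAt (fun u : ℝ => 1 + Complex.I * (u : ℂ)) Complex.I u := by
    simpa using ((hasDerivAt_id u).ofReal_comp.const_mul Complex.I).const_add 1
  have h2 := (Complex.hasDerivAt_log (z := 1 + Complex.I * u)
    (Complex.mem_slitPlane_iff.2 (Or.inl (by simp)))).comp u h1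
  refine (h2.congr_of_eventuallyEq (Eventually.of_forall fun x =>
    (log_one_add_I_mul x).symm)).congr_deriv ?_
  rw [div_eq_mul_inv, mul_comm]

theorem logOneAddI_zero : logOneAddI 0 = 0 := by simp [logOneAddI]

theorem logOneAddI_one :
    logOneAddI 1 = ((Real.log 2 / 2 : ℝ) : ℂ) + ((Real.pi / 4 : ℝ) : ℂ) * Complex.I := by
  rw [logOneAddI, Real.arctan_one]
  norm_num

/-- `l² k + 2 l Li₂(v) - 2 Li₃(v)`; for `l = log v` and `k = log (1 - v)` this is a primitive of
`-log² v / (1 - v)`. -/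
noncomputable def logSqPrimitive (l k v : ℂ) : ℂ :=
  l ^ 2 * k + 2 * l * polylogSeries 2 v - 2 * polylogSeries 3 v

/-- Leaving k free produces an error term proportional to k - log(1-v). It vanishes for k =
log(1-v), and for pairs of such primitives two errors can cancel each other. -/
theorem hasDerivAt_logSqPrimitive {l k v : ℝ → ℂ} {k' v' : ℂ} {u : ℝ}
    (hv : HasDerivAt v v' u) (hl : HasDerivAt l (v' / v u) u) (hk : HasDerivAt k k' u)
    (hv1 : ‖v u‖ < 1) (hv0 : v u ≠ 0) :
    HasDerivAt (fun u => logSqPrimitive (l u) (k u) (v u))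
      (l u ^ 2 * k' + 2 * l u * (v' / v u) * (k u - Complex.log (1 - v u))) u := by
  have h2 := (hasDerivAt_dilogSeries hv1 hv0).comp u hv
  have h3 := (hasDerivAt_polylogSeries_succ one_le_two hv1 hv0).comp u hv
  refine ((((hl.pow 2).mul hk).add ((hl.const_mul 2).mul h2)).sub (h3.const_mul 2)).congr_deriv ?_
  simp only [Function.comp_apply, Pi.pow_apply]
  field_simp
  push_cast
  ring

theorem tendsto_polylogSeries {s : ℕ} (hs : 2 ≤ s) {v : ℝ → ℂ} {F : Filter ℝ} {a : ℂ}
    (ha : ‖a‖ ≤ 1) (hv : Tendsto v F (𝓝 a)) (hm : ∀ᶠ u in F, ‖v u‖ ≤ 1) :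
    Tendsto (fun u => polylogSeries s (v u)) F (𝓝 (polylogSeries s a)) := by
  have h := continuousOn_polylogSeries hs a (by simpa using ha)
  exact Tendsto.comp h (tendsto_nhdsWithin_iff.2 ⟨hv, hm.mono fun u hu => by simpa using hu⟩)

/-- Here l(u)/u has a limit, and u log u → 0. -/
theorem tendsto_mul_log_zero {l : ℝ → ℂ} {l' : ℂ} (hl : HasDerivAt l l' 0) (h0 : l 0 = 0) :
    Tendsto (fun u : ℝ => l u * (Real.log u : ℂ)) (𝓝[>] 0) (𝓝 0) := by
  have h1 : Tendsto (fun u : ℝ => (u : ℂ)⁻¹ * l u) (𝓝[>] 0) (𝓝 l') := by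
    have := (hasDerivAt_iff_tendsto_slope_zero.1 hl).mono_left
      (nhdsWithin_mono (s := Set.Ioi 0) 0 fun x (hx : 0 < x) => hx.ne')
    simpa [h0] using this
  have h2 : Tendsto (fun u : ℝ => ((u * Real.log u : ℝ) : ℂ)) (𝓝[>] 0) (𝓝 0) := by
    have := (Real.continuous_mul_log.tendsto 0).mono_left (nhdsWithin_le_nhds (s := Set.Ioi 0))
    have h := (Complex.continuous_ofReal.tendsto _).comp this
    rwa [zero_mul, Complex.ofReal_zero] at h
  have h3 := h1.mul h2
  rw [mul_zero] at h3
  refine h3.congr' ?_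
  filter_upwards [self_mem_nhdsWithin] with u (hu : 0 < u)
  have : (u : ℂ) ≠ 0 := by exact_mod_cast hu.ne'
  push_cast
  field_simp

theorem tendsto_sq_mul_log_zero {l : ℝ → ℂ} {l' : ℂ} (hl : HasDerivAt l l' 0) (h0 : l 0 = 0) :
    Tendsto (fun u : ℝ => l u ^ 2 * (Real.log u : ℂ)) (𝓝[>] 0) (𝓝 0) := by
  have h1 : Tendsto l (𝓝[>] 0) (𝓝 0) := by
    have := hl.continuousAt.tendsto.mono_left (nhdsWithin_le_nhds (s := Set.Ioi 0))
    rwa [h0] at this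
  have h2 := h1.mul (tendsto_mul_log_zero hl h0)
  rw [mul_zero] at h2
  exact h2.congr fun u => by ring

/-- The hypothesis concerns l²k rather than k, since in the applications k contains log u and
diverges at 0. -/
theorem tendsto_logSqPrimitive_zero {l k v : ℝ → ℂ} {l' a : ℂ} (hl : HasDerivAt l l' 0)
    (h0 : l 0 = 0) (hk : Tendsto (fun u => l u ^ 2 * k u) (𝓝[>] 0) (𝓝 0)) (ha : ‖a‖ ≤ 1)
    (hv : Tendsto v (𝓝[>] 0) (𝓝 a)) (hm : ∀ᶠ u in 𝓝[>] 0, ‖v u‖ ≤ 1) :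
    Tendsto (fun u => logSqPrimitive (l u) (k u) (v u)) (𝓝[>] 0) (𝓝 (-2 * polylogSeries 3 a)) := by
  have h1 : Tendsto l (𝓝[>] 0) (𝓝 0) := by
    have := hl.continuousAt.tendsto.mono_left (nhdsWithin_le_nhds (s := Set.Ioi 0))
    rwa [h0] at this
  have h2 := tendsto_polylogSeries le_rfl ha hv hm
  have h3 := tendsto_polylogSeries (s := 3) (by norm_num) ha hv hm
  rw [show -2 * polylogSeries 3 a = 0 + 2 * 0 * polylogSeries 2 a - 2 * polylogSeries 3 a by ring]
  exact (hk.add ((h1.const_mul 2).mul h2)).sub (h3.const_mul 2)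

theorem tendsto_logSqPrimitive {l k v : ℝ → ℂ} {F : Filter ℝ} {l₀ k₀ a : ℂ}
    (hl : Tendsto l F (𝓝 l₀)) (hk : Tendsto k F (𝓝 k₀)) (ha : ‖a‖ ≤ 1)
    (hv : Tendsto v F (𝓝 a)) (hm : ∀ᶠ u in F, ‖v u‖ ≤ 1) :
    Tendsto (fun u => logSqPrimitive (l u) (k u) (v u)) F (𝓝 (logSqPrimitive l₀ k₀ a)) :=
  (((hl.pow 2).mul hk).add ((hl.const_mul 2).mul (tendsto_polylogSeries le_rfl ha hv hm))).sub
    ((tendsto_polylogSeries (by norm_num) ha hv hm).const_mul 2)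

/-! ### The path `1 / (1 + i u)` -/

theorem norm_sq_one_add_I_mul (u : ℝ) : ‖1 + Complex.I * (u : ℂ)‖ ^ 2 = 1 + u ^ 2 := by
  rw [Complex.sq_norm, Complex.normSq_apply]
  simp
  ring

theorem norm_inv_one_add_I_mul_le (u : ℝ) : ‖(1 + Complex.I * (u : ℂ))⁻¹‖ ≤ 1 := by
  rw [norm_inv]
  refine inv_le_one_of_one_le₀ ?_
  rw [← one_le_sq_iff₀ (norm_nonneg _), norm_sq_one_add_I_mul]
  nlinarith [sq_nonneg u]

theorem norm_inv_one_add_I_mul_lt {u : ℝ} (hu : 0 < u) : ‖(1 + Complex.I * (u : ℂ))⁻¹‖ < 1 := by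
  rw [norm_inv]
  refine inv_lt_one_of_one_lt₀ ?_
  rw [← one_lt_sq_iff₀ (norm_nonneg _), norm_sq_one_add_I_mul]
  nlinarith [sq_pos_of_pos hu]

theorem hasDerivAt_one_add_I_mul (u : ℝ) :
    HasDerivAt (fun u : ℝ => 1 + Complex.I * (u : ℂ)) Complex.I u := by
  simpa using ((hasDerivAt_id u).ofReal_comp.const_mul Complex.I).const_add 1

theorem hasDerivAt_inv_one_add_I_mul (u : ℝ) :
    HasDerivAt (fun u : ℝ => (1 + Complex.I * (u : ℂ))⁻¹)
      (-Complex.I / (1 + Complex.I * u) ^ 2) u :=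
  (hasDerivAt_one_add_I_mul u).inv (one_add_I_mul_ne_zero u)

/-- Both sides have the exponential iu/(1+iu), and the imaginary part π/2 - arctan u of the right
side lies on the principal branch. -/
theorem log_one_sub_inv_one_add_I_mul {u : ℝ} (hu : 0 < u) :
    Complex.log (1 - (1 + Complex.I * (u : ℂ))⁻¹)
      = Real.log u + Real.pi / 2 * Complex.I - logOneAddI u := by
  have hne := one_add_I_mul_ne_zero u
  have e : 1 - (1 + Complex.I * (u : ℂ))⁻¹
      = Complex.exp (Real.log u + Real.pi / 2 * Complex.I - logOneAddI u) := by
    rw [Complex.exp_sub, Complex.exp_add, exp_logOneAddI, Complex.exp_pi_div_two_mul_I,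
      ← Complex.ofReal_exp, Real.exp_log hu]
    field_simp
    ring
  have him : (Real.log u + Real.pi / 2 * Complex.I - logOneAddI u : ℂ).im
      = Real.pi / 2 - Real.arctan u := by
    rw [Complex.sub_im, logOneAddI_im, Complex.add_im, Complex.ofReal_im,
      show (Real.pi / 2 : ℂ) = ((Real.pi / 2 : ℝ) : ℂ) by push_cast; rfl, Complex.im_ofReal_mul]
    simp
  rw [e, Complex.log_exp]
  · rw [him]
    linarith [Real.arctan_lt_pi_div_two u, Real.pi_pos]
  · rw [him]
    linarith [Real.arctan_pos.2 hu, Real.pi_pos]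

/-- A primitive of `log² (1 + i u) / u`. -/
noncomputable def primitiveLogOneAddI (u : ℝ) : ℂ :=
  logOneAddI u ^ 3 / 3 + logSqPrimitive (-logOneAddI u)
    (Real.log u + Real.pi / 2 * Complex.I - logOneAddI u) (1 + Complex.I * (u : ℂ))⁻¹

/-- With L = log(1+iu), the logarithm of 1 - 1/(1+iu) has derivative 1/u - L'. The cubic term L³/3
removes the unwanted -L²L'. -/
theorem hasDerivAt_primitiveLogOneAddI {u : ℝ} (hu : 0 < u) :
    HasDerivAt primitiveLogOneAddI (logOneAddI u ^ 2 / u) u := by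
  have hne := one_add_I_mul_ne_zero u
  have hu0 : (u : ℂ) ≠ 0 := by exact_mod_cast hu.ne'
  have hL := hasDerivAt_logOneAddI u
  have hk : HasDerivAt (fun u : ℝ => (Real.log u : ℂ) + Real.pi / 2 * Complex.I - logOneAddI u)
      ((u : ℂ)⁻¹ - Complex.I / (1 + Complex.I * u)) u := by
    exact (((Real.hasDerivAt_log hu.ne').ofReal_comp.add_const
      ((Real.pi : ℂ) / 2 * Complex.I)).sub hL).congr_deriv (by push_cast; rfl)
  have h := hasDerivAt_logSqPrimitive (hasDerivAt_inv_one_add_I_mul u)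
    (l := fun u => -logOneAddI u) (hL.neg.congr_deriv (by field_simp)) hk
    (norm_inv_one_add_I_mul_lt hu) (inv_ne_zero hne)
  refine (((hL.pow 3).div_const 3).add h).congr_deriv ?_
  rw [log_one_sub_inv_one_add_I_mul hu]
  field_simp
  push_cast
  ring

theorem tendsto_of_continuousAt_nhdsWithin {f : ℝ → ℂ} {a : ℝ} {b : ℂ} {s : Set ℝ}
    (hf : ContinuousAt f a) (hb : f a = b) : Tendsto f (𝓝[s] a) (𝓝 b) := by
  rw [← hb]
  exact hf.tendsto.mono_left nhdsWithin_le_nhds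

theorem tendsto_primitiveLogOneAddI_zero :
    Tendsto primitiveLogOneAddI (𝓝[>] 0) (𝓝 (-2 * polylogSeries 3 1)) := by
  have hL := hasDerivAt_logOneAddI 0
  have hL0 : Tendsto logOneAddI (𝓝[>] 0) (𝓝 0) :=
    tendsto_of_continuousAt_nhdsWithin hL.continuousAt logOneAddI_zero
  have h1 := tendsto_logSqPrimitive_zero (l := fun u => -logOneAddI u)
    (k := fun u => (Real.log u : ℂ) + Real.pi / 2 * Complex.I - logOneAddI u)
    (v := fun u : ℝ => (1 + Complex.I * (u : ℂ))⁻¹) (a := 1) hL.neg (by simp [logOneAddI_zero]) ?_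
    (by simp) (tendsto_of_continuousAt_nhdsWithin
      (hasDerivAt_inv_one_add_I_mul 0).continuousAt (by simp))
    (Eventually.of_forall norm_inv_one_add_I_mul_le)
  · rw [show -2 * polylogSeries 3 1 = 0 ^ 3 / 3 + -2 * polylogSeries 3 1 by ring]
    exact ((hL0.pow 3).div_const 3).add h1
  · have h2 := (tendsto_sq_mul_log_zero hL logOneAddI_zero).add
      (((hL0.pow 2).mul_const ((Real.pi : ℂ) / 2 * Complex.I)).sub (hL0.pow 3))
    have h3 : (0 : ℂ) + (0 ^ 2 * ((Real.pi : ℂ) / 2 * Complex.I) - 0 ^ 3) = 0 := by ring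
    rw [h3] at h2
    exact h2.congr fun u => by ring

theorem inv_one_add_I : (1 + Complex.I * ((1 : ℝ) : ℂ))⁻¹ = (1 - Complex.I) / 2 := by
  rw [inv_eq_iff_eq_inv, eq_comm, inv_eq_of_mul_eq_one_left]
  push_cast
  linear_combination -(1 / 2 : ℂ) * Complex.I_sq

theorem norm_one_sub_I_div_two : ‖(1 - Complex.I) / 2‖ ≤ 1 := by
  rw [← inv_one_add_I]
  exact norm_inv_one_add_I_mul_le 1

theorem norm_one_add_I_div_two : ‖(1 + Complex.I) / 2‖ ≤ 1 := by
  have h : (1 + Complex.I) / 2 = starRingEnd ℂ ((1 - Complex.I) / 2) := by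
    rw [map_div₀, map_sub, map_one, Complex.conj_I, map_ofNat, sub_neg_eq_add]
  rw [h, Complex.norm_conj]
  exact norm_one_sub_I_div_two

theorem tendsto_primitiveLogOneAddI_one :
    Tendsto primitiveLogOneAddI (𝓝[<] 1) (𝓝 (logOneAddI 1 ^ 3 / 3 + logSqPrimitive (-logOneAddI 1)
      (Real.pi / 2 * Complex.I - logOneAddI 1) ((1 - Complex.I) / 2))) := by
  have hL := (hasDerivAt_logOneAddI 1).continuousAt
  have hL1 : Tendsto logOneAddI (𝓝[<] 1) (𝓝 (logOneAddI 1)) :=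
    tendsto_of_continuousAt_nhdsWithin hL rfl
  have hlog : Tendsto (fun u : ℝ => (Real.log u : ℂ)) (𝓝[<] 1) (𝓝 0) :=
    tendsto_of_continuousAt_nhdsWithin
      (Real.hasDerivAt_log one_ne_zero).ofReal_comp.continuousAt (by simp)
  refine ((hL1.pow 3).div_const 3).add (tendsto_logSqPrimitive hL1.neg ?_ norm_one_sub_I_div_two
    (tendsto_of_continuousAt_nhdsWithin (hasDerivAt_inv_one_add_I_mul 1).continuousAt
      inv_one_add_I) (Eventually.of_forall norm_inv_one_add_I_mul_le))
  simpa using (hlog.add_const ((Real.pi : ℂ) / 2 * Complex.I)).sub hL1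

/-- The value of `Li₂((1 - i) / 2)`. -/
theorem dilogSeries_one_sub_I_div_two :
    polylogSeries 2 ((1 - Complex.I) / 2)
      = ((Real.pi ^ 2 / 6 : ℝ) : ℂ) + polylogSeries 2 (-Complex.I)
        + Real.pi / 2 * Complex.I * logOneAddI 1 - logOneAddI 1 ^ 2 / 2 := by
  -- This combination has derivative zero on (0, 1), so its limits at the endpoints agree: Li₂(1) at
  -- 0, and an expression in Li₂((1-i)/2) and Li₂(-i) at 1.
  let f : ℝ → ℂ := fun u => polylogSeries 2 (1 + Complex.I * (u : ℂ))⁻¹ + logOneAddI u ^ 2 / 2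
    - (logOneAddI u * (Real.log u : ℂ) + logOneAddI u * (Real.pi / 2 * Complex.I))
    - polylogSeries 2 (-Complex.I * u)
  have hd : ∀ u ∈ Set.Ioo (0 : ℝ) 1, HasDerivAt f 0 u := by
    intro u hu
    have hne := one_add_I_mul_ne_zero u
    have hu0 : (u : ℂ) ≠ 0 := by exact_mod_cast hu.1.ne'
    have hL := hasDerivAt_logOneAddI u
    have hn : ‖-Complex.I * (u : ℂ)‖ < 1 := by
      rw [norm_mul, norm_neg, Complex.norm_I, one_mul, Complex.norm_real,
        Real.norm_of_nonneg hu.1.le]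
      exact hu.2
    have h1 := (hasDerivAt_dilogSeries (norm_inv_one_add_I_mul_lt hu.1) (inv_ne_zero hne)).comp u
      (hasDerivAt_inv_one_add_I_mul u)
    have hw : HasDerivAt (fun u : ℝ => -Complex.I * (u : ℂ)) (-Complex.I) u := by
      simpa using (hasDerivAt_id u).ofReal_comp.const_mul (-Complex.I)
    have h2 := (hasDerivAt_dilogSeries hn
      (mul_ne_zero (neg_ne_zero.2 Complex.I_ne_zero) hu0)).comp u hw
    have h3 := (hL.mul (Real.hasDerivAt_log hu.1.ne').ofReal_comp).add
      (hL.mul_const ((Real.pi : ℂ) / 2 * Complex.I))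
    refine (((h1.add ((hL.pow 2).div_const 2)).sub h3).sub h2).congr_deriv ?_
    rw [log_one_sub_inv_one_add_I_mul hu.1,
      show 1 - -Complex.I * (u : ℂ) = 1 + Complex.I * u by ring, log_one_add_I_mul]
    have hI := Complex.I_ne_zero
    push_cast
    field_simp
    ring
  have h0 : Tendsto f (𝓝[>] 0) (𝓝 (polylogSeries 2 1)) := by
    have hL0 : Tendsto logOneAddI (𝓝[>] 0) (𝓝 0) :=
      tendsto_of_continuousAt_nhdsWithin (hasDerivAt_logOneAddI 0).continuousAt logOneAddI_zero
    have h1 := tendsto_polylogSeries (s := 2) le_rfl (a := 1) (by simp)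
      (tendsto_of_continuousAt_nhdsWithin (s := Set.Ioi 0)
        (hasDerivAt_inv_one_add_I_mul 0).continuousAt (by simp))
      (Eventually.of_forall norm_inv_one_add_I_mul_le)
    have h2 := tendsto_polylogSeries (s := 2) le_rfl (a := 0) (by simp)
      (v := fun u : ℝ => -Complex.I * u) (tendsto_of_continuousAt_nhdsWithin (s := Set.Ioi 0)
        (a := 0) (by fun_prop) (by simp)) (by
        filter_upwards [Ioo_mem_nhdsGT (zero_lt_one' ℝ)] with u hu
        rw [norm_mul, norm_neg, Complex.norm_I, one_mul, Complex.norm_real,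
          Real.norm_of_nonneg hu.1.le]
        exact hu.2.le)
    have h3 := tendsto_mul_log_zero (hasDerivAt_logOneAddI 0) logOneAddI_zero
    have e : polylogSeries 2 1 = polylogSeries 2 1 + 0 ^ 2 / 2
        - (0 + 0 * ((Real.pi : ℂ) / 2 * Complex.I)) - polylogSeries 2 0 := by
      rw [polylogSeries_zero]
      ring
    rw [e]
    exact ((h1.add ((hL0.pow 2).div_const 2)).sub
      (h3.add (hL0.mul_const ((Real.pi : ℂ) / 2 * Complex.I)))).sub h2
  have h1 : Tendsto f (𝓝[<] 1) (𝓝 (polylogSeries 2 ((1 - Complex.I) / 2) + logOneAddI 1 ^ 2 / 2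
      - (logOneAddI 1 * 0 + logOneAddI 1 * (Real.pi / 2 * Complex.I))
      - polylogSeries 2 (-Complex.I))) := by
    have hL1 : Tendsto logOneAddI (𝓝[<] 1) (𝓝 (logOneAddI 1)) :=
      tendsto_of_continuousAt_nhdsWithin (hasDerivAt_logOneAddI 1).continuousAt rfl
    have hlog : Tendsto (fun u : ℝ => (Real.log u : ℂ)) (𝓝[<] 1) (𝓝 0) :=
      tendsto_of_continuousAt_nhdsWithin
        (Real.hasDerivAt_log one_ne_zero).ofReal_comp.continuousAt (by simp)
    have h1 := tendsto_polylogSeries (s := 2) le_rfl norm_one_sub_I_div_two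
      (tendsto_of_continuousAt_nhdsWithin (s := Set.Iio 1)
        (hasDerivAt_inv_one_add_I_mul 1).continuousAt inv_one_add_I)
      (Eventually.of_forall norm_inv_one_add_I_mul_le)
    have h2 := tendsto_polylogSeries (s := 2) le_rfl (a := -Complex.I) (by simp)
      (v := fun u : ℝ => -Complex.I * u) (tendsto_of_continuousAt_nhdsWithin (s := Set.Iio 1)
        (a := 1) (by fun_prop) (by simp)) (by
        filter_upwards [Ioo_mem_nhdsLT (zero_lt_one' ℝ)] with u hu
        rw [norm_mul, norm_neg, Complex.norm_I, one_mul, Complex.norm_real,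
          Real.norm_of_nonneg hu.1.le]
        exact hu.2.le)
    exact ((h1.add ((hL1.pow 2).div_const 2)).sub
      ((hL1.mul hlog).add (hL1.mul_const ((Real.pi : ℂ) / 2 * Complex.I)))).sub h2
  have h := intervalIntegral.integral_eq_sub_of_hasDerivAt_of_tendsto zero_lt_one hd
    intervalIntegrable_const h0 h1
  rw [intervalIntegral.integral_zero, dilogSeries_one] at h
  linear_combination -h

/-! ### Primitives with poles at v = 1 and v = i -/

/-- For `l = log v` and `k = log (1 - v) - log (1 + i v)`, a primitive of
`-log² v (1 / (1 - v) + i / (1 + i v))`. -/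
noncomputable def logSqPrimitivePair (l k v : ℂ) : ℂ :=
  logSqPrimitive l k v - logSqPrimitive l 0 (-Complex.I * v)

theorem norm_neg_I_mul (z : ℂ) : ‖-Complex.I * z‖ = ‖z‖ := by simp

theorem hasDerivAt_logSqPrimitivePair {l k v : ℝ → ℂ} {k' v' : ℂ} {u : ℝ}
    (hv : HasDerivAt v v' u) (hl : HasDerivAt l (v' / v u) u) (hk : HasDerivAt k k' u)
    (hv1 : ‖v u‖ < 1) (hv0 : v u ≠ 0)
    (hlog : k u = Complex.log (1 - v u) - Complex.log (1 + Complex.I * v u)) :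
    HasDerivAt (fun u => logSqPrimitivePair (l u) (k u) (v u)) (l u ^ 2 * k') u := by
  have hI := Complex.I_ne_zero
  have h1 := hasDerivAt_logSqPrimitive hv hl hk hv1 hv0
  have h2 := hasDerivAt_logSqPrimitive (v := fun u => -Complex.I * v u) (k := fun _ => 0)
    (hv.const_mul (-Complex.I)) (hl.congr_deriv (by field_simp)) (hasDerivAt_const u 0)
    (by rwa [norm_neg_I_mul]) (mul_ne_zero (neg_ne_zero.2 hI) hv0)
  refine (h1.sub h2).congr_deriv ?_
  rw [hlog, show 1 - -Complex.I * v u = 1 + Complex.I * v u by ring]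
  field_simp
  ring

theorem tendsto_logSqPrimitivePair_zero {l k v : ℝ → ℂ} {l' : ℂ} (hl : HasDerivAt l l' 0)
    (h0 : l 0 = 0) (hk : Tendsto (fun u => l u ^ 2 * k u) (𝓝[>] 0) (𝓝 0))
    (hv : Tendsto v (𝓝[>] 0) (𝓝 1)) (hm : ∀ᶠ u in 𝓝[>] 0, ‖v u‖ ≤ 1) :
    Tendsto (fun u => logSqPrimitivePair (l u) (k u) (v u)) (𝓝[>] 0)
      (𝓝 (-2 * polylogSeries 3 1 + 2 * polylogSeries 3 (-Complex.I))) := by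
  have h1 := tendsto_logSqPrimitive_zero hl h0 hk (by simp) hv hm
  have h2 := tendsto_logSqPrimitive_zero (k := fun _ => 0) (a := -Complex.I)
    (v := fun u => -Complex.I * v u) hl h0
    (by simp) (by simp) (by simpa using hv.const_mul (-Complex.I))
    (hm.mono fun u hu => by rwa [norm_neg_I_mul])
  rw [show -2 * polylogSeries 3 1 + 2 * polylogSeries 3 (-Complex.I)
    = -2 * polylogSeries 3 1 - -2 * polylogSeries 3 (-Complex.I) by ring]
  exact h1.sub h2

theorem log_one_add_I : Complex.log (1 + Complex.I) = logOneAddI 1 := by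
  have := log_one_add_I_mul 1
  rwa [Complex.ofReal_one, mul_one] at this

theorem log_one_sub_I :
    Complex.log (1 - Complex.I) = logOneAddI 1 - Real.pi / 2 * Complex.I := by
  have h : (1 - Complex.I) = starRingEnd ℂ (1 + Complex.I) := by
    simp [sub_eq_add_neg]
  rw [h, Complex.log_conj _ ?_, log_one_add_I, logOneAddI_one]
  · simp only [map_add, map_mul, Complex.conj_ofReal, Complex.conj_I]
    push_cast
    ring
  · have h := logOneAddI_im 1
    rw [← log_one_add_I, Complex.log_im] at h
    rw [h, Real.arctan_one]
    linarith [Real.pi_pos]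

theorem hasDerivAt_log_ofReal {u : ℝ} (hu : 0 < u) :
    HasDerivAt (fun u : ℝ => (Real.log u : ℂ)) (u : ℂ)⁻¹ u := by
  simpa using (Real.hasDerivAt_log hu.ne').ofReal_comp

/-! ### The path `(1 + i u) / (1 + u)` -/

theorem norm_one_add_I_mul_div_lt {u : ℝ} (hu : 0 < u) :
    ‖(1 + Complex.I * (u : ℂ)) / (1 + u)‖ < 1 := by
  have h : ‖(1 + u : ℂ)‖ = 1 + u := by
    rw [← Complex.ofReal_one, ← Complex.ofReal_add, Complex.norm_real,
      Real.norm_of_nonneg (by positivity)]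
  rw [norm_div, h, div_lt_one (by positivity), ← sq_lt_sq₀ (norm_nonneg _) (by positivity),
    norm_sq_one_add_I_mul]
  nlinarith

theorem hasDerivAt_one_add_I_mul_div {u : ℝ} (hu : (1 : ℂ) + u ≠ 0) :
    HasDerivAt (fun u : ℝ => (1 + Complex.I * (u : ℂ)) / (1 + u))
      ((Complex.I - 1) / (1 + u) ^ 2) u := by
  have h : HasDerivAt (fun u : ℝ => (1 : ℂ) + u) 1 u := by
    simpa using (hasDerivAt_id u).ofReal_comp.const_add 1
  refine ((hasDerivAt_one_add_I_mul u).div h hu).congr_deriv ?_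
  ring

/-- The logarithm of `(1 + i u) / (1 + u)`. -/
noncomputable def logUpperPath (u : ℝ) : ℂ := logOneAddI u - (Real.log (1 + u) : ℂ)

theorem hasDerivAt_logUpperPath {u : ℝ} (hu : 0 ≤ u) :
    HasDerivAt logUpperPath (Complex.I / (1 + Complex.I * u) - ((1 + u : ℝ) : ℂ)⁻¹) u := by
  have h : HasDerivAt (fun u : ℝ => Real.log (1 + u)) (1 + u)⁻¹ u := by
    simpa using ((hasDerivAt_id u).const_add 1).log (by positivity : (1 : ℝ) + u ≠ 0)
  exact (hasDerivAt_logOneAddI u).sub (h.ofReal_comp.congr_deriv (by push_cast; rfl))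

/-- The path is chosen so that (1-v)/(1+iv) = -iu; numerator and denominator are positive multiples
of 1-i and 1+i, which settles the branches. -/
theorem log_sub_log_upperPath {u : ℝ} (hu : 0 < u) :
    (Real.log u : ℂ) - Real.pi / 2 * Complex.I
      = Complex.log (1 - (1 + Complex.I * (u : ℂ)) / (1 + u))
        - Complex.log (1 + Complex.I * ((1 + Complex.I * (u : ℂ)) / (1 + u))) := by
  have h1u : (0 : ℝ) < 1 + u := by positivity
  have hne : (1 : ℂ) + u ≠ 0 := by exact_mod_cast h1u.ne'
  have e1 : 1 - (1 + Complex.I * (u : ℂ)) / (1 + u)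
      = ((u / (1 + u) : ℝ) : ℂ) * (1 - Complex.I) := by
    push_cast
    field_simp
    ring
  have e2 : 1 + Complex.I * ((1 + Complex.I * (u : ℂ)) / (1 + u))
      = (((1 + u)⁻¹ : ℝ) : ℂ) * (1 + Complex.I) := by
    push_cast
    field_simp
    linear_combination (u : ℂ) * Complex.I_sq
  have n1 : 1 - Complex.I ≠ 0 := fun h => by simpa using congrArg Complex.re h
  have n2 : 1 + Complex.I ≠ 0 := fun h => by simpa using congrArg Complex.re h
  rw [e1, e2, Complex.log_ofReal_mul (by positivity) n1, Complex.log_ofReal_mul (by positivity) n2,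
    log_one_add_I, log_one_sub_I, Real.log_div hu.ne' h1u.ne', Real.log_inv]
  push_cast
  ring

/-- A primitive of `log² ((1 + i u) / (1 + u)) / u`. -/
noncomputable def primitiveUpperPath (u : ℝ) : ℂ :=
  logSqPrimitivePair (logUpperPath u) (Real.log u - Real.pi / 2 * Complex.I)
    ((1 + Complex.I * (u : ℂ)) / (1 + u))

theorem hasDerivAt_primitiveUpperPath {u : ℝ} (hu : 0 < u) :
    HasDerivAt primitiveUpperPath (logUpperPath u ^ 2 / u) u := by
  have hne : (1 : ℂ) + u ≠ 0 := by
    have : (0 : ℝ) < 1 + u := by positivity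
    exact_mod_cast this.ne'
  have hn := one_add_I_mul_ne_zero u
  refine hasDerivAt_logSqPrimitivePair (hasDerivAt_one_add_I_mul_div hne)
    ((hasDerivAt_logUpperPath hu.le).congr_deriv ?_)
    ((hasDerivAt_log_ofReal hu).sub_const _) (norm_one_add_I_mul_div_lt hu)
    (div_ne_zero hn hne) (log_sub_log_upperPath hu)
  push_cast
  field_simp
  ring

theorem tendsto_primitiveUpperPath_zero :
    Tendsto primitiveUpperPath (𝓝[>] 0)
      (𝓝 (-2 * polylogSeries 3 1 + 2 * polylogSeries 3 (-Complex.I))) := by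
  have hl := hasDerivAt_logUpperPath le_rfl
  have h0 : logUpperPath 0 = 0 := by simp [logUpperPath, logOneAddI_zero]
  have hl0 : Tendsto logUpperPath (𝓝[>] 0) (𝓝 0) :=
    tendsto_of_continuousAt_nhdsWithin hl.continuousAt h0
  refine tendsto_logSqPrimitivePair_zero hl h0 ?_ (tendsto_of_continuousAt_nhdsWithin
    (hasDerivAt_one_add_I_mul_div (by simp)).continuousAt (by simp)) ?_
  · have h := (tendsto_sq_mul_log_zero hl h0).sub
      ((hl0.pow 2).mul_const ((Real.pi : ℂ) / 2 * Complex.I))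
    rw [show (0 : ℂ) - 0 ^ 2 * ((Real.pi : ℂ) / 2 * Complex.I) = 0 by ring] at h
    exact h.congr fun u => by ring
  · filter_upwards [self_mem_nhdsWithin] with u hu using (norm_one_add_I_mul_div_lt hu).le

theorem tendsto_primitiveUpperPath_one :
    Tendsto primitiveUpperPath (𝓝[<] 1)
      (𝓝 (logSqPrimitivePair (logOneAddI 1 - (Real.log 2 : ℂ)) (-(Real.pi / 2 * Complex.I))
        ((1 + Complex.I) / 2))) := by
  have hpos : ∀ᶠ u : ℝ in 𝓝[<] 1, ‖(1 + Complex.I * (u : ℂ)) / (1 + u)‖ ≤ 1 := by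
    filter_upwards [Ioo_mem_nhdsLT (zero_lt_one' ℝ)] with u hu
      using (norm_one_add_I_mul_div_lt hu.1).le
  have hl : Tendsto logUpperPath (𝓝[<] 1) (𝓝 (logOneAddI 1 - (Real.log 2 : ℂ))) :=
    tendsto_of_continuousAt_nhdsWithin (hasDerivAt_logUpperPath zero_le_one).continuousAt (by
      rw [logUpperPath, one_add_one_eq_two])
  have hk : Tendsto (fun u : ℝ => (Real.log u : ℂ) - Real.pi / 2 * Complex.I) (𝓝[<] 1)
      (𝓝 (-(Real.pi / 2 * Complex.I))) :=
    tendsto_of_continuousAt_nhdsWithin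
      ((hasDerivAt_log_ofReal one_pos).sub_const _).continuousAt (by simp)
  have hv : Tendsto (fun u : ℝ => (1 + Complex.I * (u : ℂ)) / (1 + u)) (𝓝[<] 1)
      (𝓝 ((1 + Complex.I) / 2)) :=
    tendsto_of_continuousAt_nhdsWithin
      (hasDerivAt_one_add_I_mul_div (by norm_num)).continuousAt (by norm_num)
  exact (tendsto_logSqPrimitive hl hk norm_one_add_I_div_two hv hpos).sub
    (tendsto_logSqPrimitive hl tendsto_const_nhds (by rw [norm_neg_I_mul]; exact norm_one_add_I_div_two)
      (hv.const_mul (-Complex.I)) (hpos.mono fun u hu => by rwa [norm_neg_I_mul]))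

/-! ### The path `(1 - u) / (1 + i u)` -/

theorem norm_one_sub_div_lt {u : ℝ} (hu : 0 < u) (hu1 : u ≤ 1) :
    ‖(1 - (u : ℂ)) / (1 + Complex.I * u)‖ < 1 := by
  have h : ‖(1 - u : ℂ)‖ = 1 - u := by
    rw [← Complex.ofReal_one, ← Complex.ofReal_sub, Complex.norm_real,
      Real.norm_of_nonneg (by linarith)]
  rw [norm_div, h, div_lt_one (norm_pos_iff.2 (one_add_I_mul_ne_zero u)),
    ← sq_lt_sq₀ (by linarith) (norm_nonneg _), norm_sq_one_add_I_mul]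
  nlinarith

theorem hasDerivAt_one_sub_div (u : ℝ) :
    HasDerivAt (fun u : ℝ => (1 - (u : ℂ)) / (1 + Complex.I * u))
      (-(1 + Complex.I) / (1 + Complex.I * u) ^ 2) u := by
  have h : HasDerivAt (fun u : ℝ => (1 : ℂ) - u) (-1) u := by
    simpa using (hasDerivAt_id u).ofReal_comp.const_sub 1
  refine (h.div (hasDerivAt_one_add_I_mul u) (one_add_I_mul_ne_zero u)).congr_deriv ?_
  ring

/-- The logarithm of `(1 - u) / (1 + i u)`. -/
noncomputable def logLowerPath (u : ℝ) : ℂ := (Real.log (1 - u) : ℂ) - logOneAddI u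

theorem hasDerivAt_logLowerPath {u : ℝ} (hu : u < 1) :
    HasDerivAt logLowerPath (-((1 - u : ℝ) : ℂ)⁻¹ - Complex.I / (1 + Complex.I * u)) u := by
  have h : HasDerivAt (fun u : ℝ => Real.log (1 - u)) (-(1 - u)⁻¹) u := by
    refine (((hasDerivAt_id u).const_sub 1).log (sub_pos.2 hu).ne').congr_deriv ?_
    simp [div_eq_mul_inv]
  exact (h.ofReal_comp.congr_deriv (by push_cast; rfl)).sub (hasDerivAt_logOneAddI u)

/-- Along this path (1-v)/(1+iv) = u is positive, so both logarithms have the same argument. -/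
theorem log_sub_log_lowerPath {u : ℝ} (hu : 0 < u) :
    (Real.log u : ℂ) = Complex.log (1 - (1 - (u : ℂ)) / (1 + Complex.I * u))
        - Complex.log (1 + Complex.I * ((1 - (u : ℂ)) / (1 + Complex.I * u))) := by
  have hn := one_add_I_mul_ne_zero u
  have n2 : 1 + Complex.I ≠ 0 := fun h => by simpa using congrArg Complex.re h
  have e2 : 1 + Complex.I * ((1 - (u : ℂ)) / (1 + Complex.I * u))
      = (1 + Complex.I) / (1 + Complex.I * u) := by
    field_simp
    ring
  have e1 : 1 - (1 - (u : ℂ)) / (1 + Complex.I * u)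
      = (u : ℂ) * ((1 + Complex.I) / (1 + Complex.I * u)) := by
    linear_combination -mul_inv_cancel₀ hn
  rw [e1, e2, Complex.log_ofReal_mul hu (div_ne_zero n2 hn)]
  ring

/-- A primitive of `log² ((1 - u) / (1 + i u)) / u`. -/
noncomputable def primitiveLowerPath (u : ℝ) : ℂ :=
  logSqPrimitivePair (logLowerPath u) (Real.log u) ((1 - (u : ℂ)) / (1 + Complex.I * u))

theorem hasDerivAt_primitiveLowerPath {u : ℝ} (hu : 0 < u) (hu1 : u < 1) :
    HasDerivAt primitiveLowerPath (logLowerPath u ^ 2 / u) u := by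
  have hne : (1 : ℂ) - u ≠ 0 := by
    have : (0 : ℝ) < 1 - u := sub_pos.2 hu1
    exact_mod_cast this.ne'
  have hn := one_add_I_mul_ne_zero u
  refine hasDerivAt_logSqPrimitivePair (hasDerivAt_one_sub_div u)
    ((hasDerivAt_logLowerPath hu1).congr_deriv ?_)
    (hasDerivAt_log_ofReal hu) (norm_one_sub_div_lt hu hu1.le)
    (div_ne_zero hne hn) (log_sub_log_lowerPath hu)
  -- This splitting is the partial fraction decomposition of v'/v.
  rw [show 1 + Complex.I = (1 + Complex.I * u) + Complex.I * (1 - u) by ring]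
  push_cast
  generalize 1 + Complex.I * (u : ℂ) = w at hn ⊢
  generalize 1 - (u : ℂ) = x at hne ⊢
  field_simp
  ring

theorem tendsto_primitiveLowerPath_zero :
    Tendsto primitiveLowerPath (𝓝[>] 0)
      (𝓝 (-2 * polylogSeries 3 1 + 2 * polylogSeries 3 (-Complex.I))) := by
  have hl := hasDerivAt_logLowerPath one_pos
  have h0 : logLowerPath 0 = 0 := by simp [logLowerPath, logOneAddI_zero]
  refine tendsto_logSqPrimitivePair_zero hl h0 (tendsto_sq_mul_log_zero hl h0)
    (tendsto_of_continuousAt_nhdsWithin (hasDerivAt_one_sub_div 0).continuousAt (by simp)) ?_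
  filter_upwards [Ioo_mem_nhdsGT (zero_lt_one' ℝ)] with u hu
    using (norm_one_sub_div_lt hu.1 hu.2.le).le

/-- Linear decay at 0 is needed for the lower path at u → 1, where Li₂(v) is multiplied by a
diverging logarithm. -/
theorem norm_dilogSeries_le {z : ℂ} (hz : ‖z‖ ≤ 1) :
    ‖polylogSeries 2 z‖ ≤ Real.pi ^ 2 / 6 * ‖z‖ := by
  have h := hasSum_one_div_succ_sq.mul_right ‖z‖
  refine tsum_of_norm_bounded h fun k => ?_
  have h1 := norm_polylog_term_le (s := 2) le_rfl (z := 1) (by simp) k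
  rw [one_pow] at h1
  rw [show z ^ (k + 1) / ((k : ℂ) + 1) ^ 2 = 1 / ((k : ℂ) + 1) ^ 2 * (z ^ k * z) by ring,
    norm_mul, norm_mul, norm_pow]
  refine mul_le_mul h1 ?_ (by positivity) (by positivity)
  exact mul_le_of_le_one_left (norm_nonneg _) (pow_le_one₀ (norm_nonneg _) hz)

theorem tendsto_mul_dilogSeries {l v : ℝ → ℂ} {F : Filter ℝ}
    (hl : Tendsto (fun u => l u * v u) F (𝓝 0)) (hm : ∀ᶠ u in F, ‖v u‖ ≤ 1) :
    Tendsto (fun u => l u * polylogSeries 2 (v u)) F (𝓝 0) := by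
  rw [tendsto_zero_iff_norm_tendsto_zero] at hl
  have h := hl.const_mul (Real.pi ^ 2 / 6)
  rw [mul_zero] at h
  refine squeeze_zero_norm' (hm.mono fun u hu => ?_) h
  rw [norm_mul, norm_mul]
  have := mul_le_mul_of_nonneg_left (norm_dilogSeries_le hu) (norm_nonneg (l u))
  linarith

theorem tendsto_one_sub_mul_log :
    Tendsto (fun u : ℝ => (1 - u) * Real.log (1 - u)) (𝓝[<] 1) (𝓝 0) := by
  have h : Tendsto (fun u : ℝ => 1 - u) (𝓝[<] 1) (𝓝 0) := by
    have : ContinuousAt (fun u : ℝ => 1 - u) 1 := by fun_prop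
    have h := this.tendsto.mono_left (nhdsWithin_le_nhds (s := Set.Iio 1))
    rwa [sub_self] at h
  have h1 := (Real.continuous_mul_log.tendsto 0).comp h
  rwa [zero_mul] at h1

theorem tendsto_one_sub_mul_log_sq :
    Tendsto (fun u : ℝ => (1 - u) * Real.log (1 - u) ^ 2) (𝓝[<] 1) (𝓝 0) := by
  have h : Tendsto (fun u : ℝ => Real.sqrt (1 - u)) (𝓝[<] 1) (𝓝 0) := by
    have : ContinuousAt (fun u : ℝ => Real.sqrt (1 - u)) 1 := by fun_prop
    have h := this.tendsto.mono_left (nhdsWithin_le_nhds (s := Set.Iio 1))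
    rwa [sub_self, Real.sqrt_zero] at h
  have h1 := (((Real.continuous_mul_log.tendsto 0).comp h).const_mul 2).pow 2
  rw [zero_mul, mul_zero, zero_pow two_ne_zero] at h1
  refine h1.congr' ?_
  filter_upwards [self_mem_nhdsWithin] with u (hu : u < 1)
  have hs := Real.sq_sqrt (sub_pos.2 hu).le
  rw [Function.comp_apply, Real.log_sqrt (sub_pos.2 hu).le]
  linear_combination Real.log (1 - u) ^ 2 * hs

/-- As u → 1 the logarithm l of the path diverges like log(1-u), while v and log u vanish to first
order in 1-u; so l²log u and l Li₂(v) both tend to 0. -/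
theorem tendsto_primitiveLowerPath_one : Tendsto primitiveLowerPath (𝓝[<] 1) (𝓝 0) := by
  have hpos : ∀ᶠ u : ℝ in 𝓝[<] 1, ‖(1 - (u : ℂ)) / (1 + Complex.I * u)‖ ≤ 1 := by
    filter_upwards [Ioo_mem_nhdsLT (zero_lt_one' ℝ)] with u hu
      using (norm_one_sub_div_lt hu.1 hu.2.le).le
  have hv : Tendsto (fun u : ℝ => (1 - (u : ℂ)) / (1 + Complex.I * u)) (𝓝[<] 1) (𝓝 0) :=
    tendsto_of_continuousAt_nhdsWithin (hasDerivAt_one_sub_div 1).continuousAt (by simp)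
  have hL : Tendsto logOneAddI (𝓝[<] 1) (𝓝 (logOneAddI 1)) :=
    tendsto_of_continuousAt_nhdsWithin (hasDerivAt_logOneAddI 1).continuousAt rfl
  have h1 : Tendsto (fun u : ℝ => (((1 - u) * Real.log (1 - u) : ℝ) : ℂ)) (𝓝[<] 1) (𝓝 0) := by
    have := (Complex.continuous_ofReal.tendsto _).comp tendsto_one_sub_mul_log
    rwa [Complex.ofReal_zero] at this
  have h2 : Tendsto (fun u : ℝ => (((1 - u) * Real.log (1 - u) ^ 2 : ℝ) : ℂ)) (𝓝[<] 1) (𝓝 0) := by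
    have := (Complex.continuous_ofReal.tendsto _).comp tendsto_one_sub_mul_log_sq
    rwa [Complex.ofReal_zero] at this
  have h3 : Tendsto (fun u : ℝ => ((1 - u : ℝ) : ℂ)) (𝓝[<] 1) (𝓝 0) :=
    tendsto_of_continuousAt_nhdsWithin (by fun_prop) (by simp)
  have hinv : Tendsto (fun u : ℝ => (1 + Complex.I * (u : ℂ))⁻¹) (𝓝[<] 1)
      (𝓝 (1 + Complex.I * ((1 : ℝ) : ℂ))⁻¹) :=
    tendsto_of_continuousAt_nhdsWithin (hasDerivAt_inv_one_add_I_mul 1).continuousAt rfl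
  have hlv : Tendsto (fun u : ℝ => logLowerPath u * ((1 - (u : ℂ)) / (1 + Complex.I * u)))
      (𝓝[<] 1) (𝓝 0) := by
    have h := (h1.sub (h3.mul hL)).mul hinv
    rw [zero_mul, sub_zero, zero_mul] at h
    refine h.congr fun u => ?_
    rw [logLowerPath]
    push_cast
    ring
  have hll : Tendsto (fun u : ℝ => logLowerPath u ^ 2 * (Real.log u : ℂ)) (𝓝[<] 1) (𝓝 0) := by
    have hslope : Tendsto (fun u : ℝ => (((u - 1)⁻¹ * Real.log u : ℝ) : ℂ)) (𝓝[<] 1) (𝓝 1) := by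
      have := (hasDerivAt_iff_tendsto_slope.1 (Real.hasDerivAt_log one_ne_zero)).mono_left
        (nhdsWithin_mono (s := Set.Iio 1) 1 fun x (hx : x < 1) => hx.ne)
      simp only [slope_fun_def, Real.log_one, vsub_eq_sub, sub_zero, smul_eq_mul, inv_one] at this
      have h := (Complex.continuous_ofReal.tendsto _).comp this
      rwa [Complex.ofReal_one] at h
    have h := (((h2.sub ((h1.mul hL).const_mul 2)).add (h3.mul (hL.pow 2))).mul hslope).neg
    rw [zero_mul, mul_zero, sub_zero, zero_mul, add_zero, zero_mul, neg_zero] at h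
    refine h.congr' ?_
    filter_upwards [self_mem_nhdsWithin] with u (hu : u < 1)
    have hne : (u : ℂ) - 1 ≠ 0 := by
      have : u - 1 ≠ 0 := (sub_neg.2 hu).ne
      exact_mod_cast this
    rw [logLowerPath]
    push_cast
    field_simp
    ring
  have hd1 := tendsto_mul_dilogSeries hlv hpos
  have hpos' := hpos.mono fun u hu => (norm_neg_I_mul _).trans_le hu
  have hd2 := tendsto_mul_dilogSeries (l := logLowerPath)
    (v := fun u : ℝ => -Complex.I * ((1 - (u : ℂ)) / (1 + Complex.I * u)))
    (by simpa [mul_left_comm] using hlv.const_mul (-Complex.I)) hpos'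
  have ht1 := tendsto_polylogSeries (s := 3) (by norm_num) (a := 0) (by simp) hv hpos
  have ht2 := tendsto_polylogSeries (s := 3) (by norm_num) (a := 0) (by simp)
    (by simpa using hv.const_mul (-Complex.I)) hpos'
  have h := ((hll.add (hd1.const_mul 2)).sub (ht1.const_mul 2)).sub
    ((hd2.const_mul 2).sub (ht2.const_mul 2))
  simp only [polylogSeries_zero, mul_zero, add_zero, sub_zero] at h
  refine h.congr fun u => ?_
  simp only [primitiveLowerPath, logSqPrimitivePair, logSqPrimitive]
  ring

/-! ### Evaluation of the moment sum at index 0 -/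

theorem im_sq_div_ofReal (z : ℂ) (u : ℝ) : (z ^ 2 / (u : ℂ)).im = 2 * z.re * z.im / u := by
  rw [Complex.div_ofReal_im, sq, Complex.mul_im]
  ring

theorem HasDerivAt.complex_im {f : ℝ → ℂ} {f' : ℂ} {u : ℝ} (h : HasDerivAt f f' u) :
    HasDerivAt (fun u => (f u).im) f'.im u :=
  Complex.imCLM.hasFDerivAt.comp_hasDerivAt u h

theorem HasDerivAt.complex_re {f : ℝ → ℂ} {f' : ℂ} {u : ℝ} (h : HasDerivAt f f' u) :
    HasDerivAt (fun u => (f u).re) f'.re u :=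
  Complex.reCLM.hasFDerivAt.comp_hasDerivAt u h

theorem Filter.Tendsto.complex_im {f : ℝ → ℂ} {F : Filter ℝ} {a : ℂ} (h : Tendsto f F (𝓝 a)) :
    Tendsto (fun u => (f u).im) F (𝓝 a.im) :=
  (Complex.continuous_im.tendsto a).comp h

theorem Filter.Tendsto.complex_re {f : ℝ → ℂ} {F : Filter ℝ} {a : ℂ} (h : Tendsto f F (𝓝 a)) :
    Tendsto (fun u => (f u).re) F (𝓝 a.re) :=
  (Complex.continuous_re.tendsto a).comp h

theorem norm_ofReal_sq_le_one {t : ℝ} (ht : 0 ≤ t) (ht1 : t ≤ 1) : ‖(t : ℂ) ^ 2‖ ≤ 1 := by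
  rw [norm_pow, Complex.norm_real, Real.norm_of_nonneg ht]
  exact pow_le_one₀ ht ht1

/-- A primitive of `Li₂(t²) / (1 + t²)` on `(0, 1)`. -/
noncomputable def dilogArctanPrimitive (t : ℝ) : ℝ :=
  Real.arctan t * (polylogSeries 2 ((t : ℂ) ^ 2)).re + 2 * (primitiveLogOneAddI t).im
    - (primitiveLowerPath t).im - (primitiveUpperPath t).im

/-- Im z² = 2 Re z Im z turns each squared logarithm into arctan t times a real logarithm. In the
combination 2, -1, -1 the log(1+t²) parts cancel and 2 arctan t · log(1-t²)/t is left, which offsets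
the derivative of Li₂(t²) in the product. -/
theorem hasDerivAt_dilogArctanPrimitive {t : ℝ} (ht : 0 < t) (ht1 : t < 1) :
    HasDerivAt dilogArctanPrimitive ((polylogSeries 2 ((t : ℂ) ^ 2)).re / (1 + t ^ 2)) t := by
  have hn : ‖(t : ℂ) ^ 2‖ < 1 := by
    rw [norm_pow, Complex.norm_real, Real.norm_of_nonneg ht.le]
    exact pow_lt_one₀ ht.le ht1 two_ne_zero
  have ht0 : (t : ℂ) ≠ 0 := by exact_mod_cast ht.ne'
  have hsq : HasDerivAt (fun t : ℝ => (t : ℂ) ^ 2) (2 * t) t := by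
    exact ((hasDerivAt_id t).ofReal_comp.pow 2).congr_deriv (by simp)
  have hd := ((hasDerivAt_dilogSeries hn (pow_ne_zero 2 ht0)).comp t hsq).complex_re
  have hlog : -Complex.log (1 - (t : ℂ) ^ 2) / (t : ℂ) ^ 2 * (2 * t)
      = ((-2 * (Real.log (1 - t) + Real.log (1 + t)) / t : ℝ) : ℂ) := by
    rw [← Real.log_mul (by linarith) (by linarith), show (1 - t) * (1 + t) = 1 - t ^ 2 by ring]
    push_cast
    rw [Complex.ofReal_log (by nlinarith)]
    push_cast
    field_simp
  rw [hlog, Complex.ofReal_re] at hd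
  have h := ((((Real.hasDerivAt_arctan t).mul hd).add
    ((hasDerivAt_primitiveLogOneAddI ht).complex_im.const_mul 2)).sub
    (hasDerivAt_primitiveLowerPath ht ht1).complex_im).sub
    (hasDerivAt_primitiveUpperPath ht).complex_im
  refine h.congr_deriv ?_
  simp only [im_sq_div_ofReal, logLowerPath, logUpperPath, Complex.sub_re, Complex.sub_im,
    logOneAddI_re, logOneAddI_im, Complex.ofReal_re, Complex.ofReal_im, Function.comp_apply]
  have : 1 + t ^ 2 ≠ 0 := by positivity
  field_simp
  ring

theorem trilogSeries_neg_I_im : (polylogSeries 3 (-Complex.I)).im = -(Real.pi ^ 3 / 32) := by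
  rw [← Complex.conj_I, polylogSeries_conj, Complex.conj_im, trilogSeries_I_im]

/-- Li₃(1) is real, so only the two Li₃(-i) terms count, each giving π³/16. -/
theorem tendsto_dilogArctanPrimitive_zero :
    Tendsto dilogArctanPrimitive (𝓝[>] 0) (𝓝 (Real.pi ^ 3 / 8)) := by
  have h1 : Tendsto (fun t : ℝ => Real.arctan t) (𝓝[>] 0) (𝓝 0) := by
    have := (Real.continuous_arctan.tendsto 0).mono_left (nhdsWithin_le_nhds (s := Set.Ioi 0))
    rwa [Real.arctan_zero] at this
  have h2 := (tendsto_polylogSeries (s := 2) le_rfl (a := 0) (by simp)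
    (v := fun t : ℝ => (t : ℂ) ^ 2) (tendsto_of_continuousAt_nhdsWithin (s := Set.Ioi 0)
      (a := 0) (by fun_prop) (by simp)) (by
    filter_upwards [Ioo_mem_nhdsGT (zero_lt_one' ℝ)] with t ht
      using norm_ofReal_sq_le_one ht.1.le ht.2.le)).complex_re
  have h := (((h1.mul h2).add (tendsto_primitiveLogOneAddI_zero.complex_im.const_mul 2)).sub
    tendsto_primitiveLowerPath_zero.complex_im).sub tendsto_primitiveUpperPath_zero.complex_im
  have e1 : ∀ z : ℂ, (-2 * z).im = -2 * z.im := fun z => by simp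
  have e2 : ∀ z : ℂ, (2 * z).im = 2 * z.im := fun z => by simp
  rw [Complex.add_im, e1, e2, trilogSeries_one_im, trilogSeries_neg_I_im] at h
  rw [show Real.pi ^ 3 / 8 = 0 * (polylogSeries 2 0).re + 2 * (-2 * 0)
    - (-2 * 0 + 2 * -(Real.pi ^ 3 / 32)) - (-2 * 0 + 2 * -(Real.pi ^ 3 / 32)) by ring]
  exact h

theorem tendsto_dilogArctanPrimitive_one :
    Tendsto dilogArctanPrimitive (𝓝[<] 1) (𝓝 (Real.pi / 4 * (Real.pi ^ 2 / 6)
      + 2 * (logOneAddI 1 ^ 3 / 3 + logSqPrimitive (-logOneAddI 1)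
        (Real.pi / 2 * Complex.I - logOneAddI 1) ((1 - Complex.I) / 2)).im
      - (logSqPrimitivePair (logOneAddI 1 - (Real.log 2 : ℂ)) (-(Real.pi / 2 * Complex.I))
        ((1 + Complex.I) / 2)).im)) := by
  have h1 : Tendsto (fun t : ℝ => Real.arctan t) (𝓝[<] 1) (𝓝 (Real.pi / 4)) := by
    have := (Real.continuous_arctan.tendsto 1).mono_left (nhdsWithin_le_nhds (s := Set.Iio 1))
    rwa [Real.arctan_one] at this
  have h2 := (tendsto_polylogSeries (s := 2) le_rfl (a := 1) (by simp)
    (v := fun t : ℝ => (t : ℂ) ^ 2) (tendsto_of_continuousAt_nhdsWithin (s := Set.Iio 1)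
      (a := 1) (by fun_prop) (by simp)) (by
    filter_upwards [Ioo_mem_nhdsLT (zero_lt_one' ℝ)] with t ht
      using norm_ofReal_sq_le_one ht.1.le ht.2.le)).complex_re
  rw [dilogSeries_one, Complex.ofReal_re] at h2
  have h := (((h1.mul h2).add (tendsto_primitiveLogOneAddI_one.complex_im.const_mul 2)).sub
    tendsto_primitiveLowerPath_one.complex_im).sub tendsto_primitiveUpperPath_one.complex_im
  rw [Complex.zero_im, sub_zero] at h
  exact h

theorem dilogSeries_one_sub_I_div_two_re_im :
    (polylogSeries 2 ((1 - Complex.I) / 2)).re = 5 * Real.pi ^ 2 / 96 - Real.log 2 ^ 2 / 8 ∧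
    (polylogSeries 2 ((1 - Complex.I) / 2)).im = -catalanG + Real.pi * Real.log 2 / 8 := by
  have h : polylogSeries 2 ((1 - Complex.I) / 2)
      = ((5 * Real.pi ^ 2 / 96 - Real.log 2 ^ 2 / 8 : ℝ) : ℂ)
        + ((-catalanG + Real.pi * Real.log 2 / 8 : ℝ) : ℂ) * Complex.I := by
    have hI : polylogSeries 2 (-Complex.I)
        = ((-(Real.pi ^ 2 / 48) : ℝ) : ℂ) - (catalanG : ℂ) * Complex.I := by
      rw [← Complex.conj_I, polylogSeries_conj, ← Complex.re_add_im (polylogSeries 2 Complex.I),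
        dilogSeries_I_re, dilogSeries_I_im]
      simp only [map_add, map_mul, Complex.conj_ofReal, Complex.conj_I]
      ring
    rw [dilogSeries_one_sub_I_div_two, hI, logOneAddI_one]
    push_cast
    linear_combination (3 * (Real.pi : ℂ) ^ 2 / 32) * Complex.I_sq
  rw [h]
  simp only [Complex.add_re, Complex.add_im, Complex.re_ofReal_mul, Complex.im_ofReal_mul,
    Complex.ofReal_re, Complex.ofReal_im, Complex.I_re, Complex.I_im]
  constructor <;> ring

/-- Inversion at z = 1 + i: the inverse (1-i)/2 lies in the disc, and log z - πi = (log 2)/2 -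
3πi/4. -/
theorem trilog_one_add_I_im :
    (trilog (1 + Complex.I)).im = (polylogSeries 3 ((1 - Complex.I) / 2)).im
      + 7 * Real.pi ^ 3 / 128 + 3 * Real.pi * Real.log 2 ^ 2 / 32 := by
  have him : (0 : ℝ) < (1 + Complex.I).im := by simp
  have h := trilog_sub_trilog_inv him
  have hinv : (1 + Complex.I)⁻¹ = (1 - Complex.I) / 2 := by
    have := inv_one_add_I
    rwa [Complex.ofReal_one, mul_one] at this
  rw [hinv, trilog_eq_polylogSeries' norm_one_sub_I_div_two
    (mem_cutPlane_of_im_ne_zero (by simp)), log_one_add_I, logOneAddI_one] at h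
  have h1 : trilog (1 + Complex.I) = polylogSeries 3 ((1 - Complex.I) / 2)
      + (((-(Real.log 2 ^ 3 / 48) + Real.log 2 * Real.pi ^ 2 * (9 / 64 - 1 / 12) : ℝ) : ℂ)
      + ((7 * Real.pi ^ 3 / 128 + 3 * Real.pi * Real.log 2 ^ 2 / 32 : ℝ) : ℂ) * Complex.I) := by
    push_cast at h ⊢
    linear_combination h + (-(9 / 64) * (Real.log 2 : ℂ) * Real.pi ^ 2
      + 9 / 128 * (Real.pi : ℂ) ^ 3 * Complex.I) * Complex.I_sq
  rw [h1]
  simp only [Complex.add_im, Complex.im_ofReal_mul, Complex.ofReal_im, Complex.I_im]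
  ring

theorem momentSum_zero :
    momentSum 0 = 1 / 2 * Real.log 2 ^ 2 * Real.pi + 11 * Real.pi ^ 3 / 48
      + 4 * catalanG * Real.log 2 - 8 * (trilog (1 + Complex.I)).im := by
  have hcont : ContinuousOn
      (fun t : ℝ => (polylogSeries 2 ((t : ℂ) ^ 2)).re / (1 + t ^ 2)) (Set.uIcc 0 1) := by
    rw [Set.uIcc_of_le zero_le_one]
    refine ContinuousOn.div (Complex.continuous_re.comp_continuousOn
      ((continuousOn_polylogSeries le_rfl).comp (by fun_prop) fun t ht => ?_))
      (by fun_prop) fun t _ => by positivity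
    simpa using norm_ofReal_sq_le_one ht.1 ht.2
  have h := intervalIntegral.integral_eq_sub_of_hasDerivAt_of_tendsto zero_lt_one
    (fun t ht => hasDerivAt_dilogArctanPrimitive ht.1 ht.2) hcont.intervalIntegrable
    tendsto_dilogArctanPrimitive_zero tendsto_dilogArctanPrimitive_one
  rw [momentSum_zero_eq_integral] at h
  obtain ⟨hre, him⟩ := dilogSeries_one_sub_I_div_two_re_im
  have hconj : (1 + Complex.I) / 2 = starRingEnd ℂ ((1 - Complex.I) / 2) := by
    rw [map_div₀, map_sub, map_one, Complex.conj_I, map_ofNat, sub_neg_eq_add]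
  -- Thus both members of the pair primitive involve only (1-i)/2 and its conjugate.
  have hw : -Complex.I * starRingEnd ℂ ((1 - Complex.I) / 2) = (1 - Complex.I) / 2 := by
    rw [← hconj]
    linear_combination -(1 / 2 : ℂ) * Complex.I_sq
  have hX := trilog_one_add_I_im
  rw [h, hX, hconj]
  simp only [logSqPrimitivePair, logSqPrimitive]
  rw [hw, polylogSeries_conj, polylogSeries_conj]
  have hd : polylogSeries 2 ((1 - Complex.I) / 2)
      = ((5 * Real.pi ^ 2 / 96 - Real.log 2 ^ 2 / 8 : ℝ) : ℂ)
        + ((-catalanG + Real.pi * Real.log 2 / 8 : ℝ) : ℂ) * Complex.I := by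
    rw [← hre, ← him, Complex.re_add_im]
  have ht := (Complex.re_add_im (polylogSeries 3 ((1 - Complex.I) / 2))).symm
  rw [hd, logOneAddI_one]
  -- What remains is a polynomial identity in these constants once real and imaginary parts are
  -- separated.
  generalize (polylogSeries 3 ((1 - Complex.I) / 2)) = T
  generalize catalanG = G
  generalize Real.log 2 = s
  generalize Real.pi = p
  have e3 : ∀ z : ℂ, (z / 3).im = z.im / 3 := fun z => by
    rw [show (3 : ℂ) = ((3 : ℝ) : ℂ) by push_cast; rfl, Complex.div_ofReal_im]
  have ep : (p : ℂ) / 2 = ((p / 2 : ℝ) : ℂ) := by push_cast; rfl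
  simp only [map_add, map_mul, Complex.conj_ofReal, Complex.conj_I, pow_succ, pow_zero, one_mul,
    e3, ep, Complex.add_im, Complex.sub_im, Complex.mul_im, Complex.neg_im, Complex.ofReal_im,
    Complex.add_re, Complex.sub_re, Complex.mul_re, Complex.neg_re, Complex.ofReal_re,
    Complex.I_re, Complex.I_im, Complex.conj_re, Complex.conj_im, Complex.re_ofNat,
    Complex.im_ofNat, Complex.zero_re, Complex.zero_im]
  ring

end PathPrimitives

/-! ### Higher moment sums and assembly of the four cases -/

theorem sum_one_div_two_mul_add_one (r : ℕ) :
    ∑ j ∈ Finset.range (r + 1), 1 / (2 * (j : ℝ) + 1)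
      = (harmonic (2 * r + 1) : ℝ) - (harmonic r : ℝ) / 2 := by
  induction r with
  | zero => simp [harmonic_succ]
  | succ r ih =>
    rw [Finset.sum_range_succ, ih, show 2 * (r + 1) + 1 = 2 * r + 1 + 1 + 1 by ring,
      harmonic_succ (2 * r + 1 + 1), harmonic_succ (2 * r + 1), harmonic_succ r]
    push_cast
    have h1 : (r : ℝ) + 1 ≠ 0 := by positivity
    have h2 : 2 * ((r : ℝ) + 1) + 1 ≠ 0 := by positivity
    rw [show 2 * (r : ℝ) + 1 + 1 = 2 * (r + 1) by ring]
    field_simp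
    ring

theorem momentSum_add_two (r : ℕ) :
    momentSum (r + 2) = momentSum r + mixedSum (r + 1) - mixedSum r := by
  linarith [momentSum_add_succ r, momentSum_add_succ (r + 1)]

/-- This is the increment from S(r) to S(r+2); its pieces are the summands of the finite sums in the
final formulas. -/
theorem mixedSum_succ_sub (r : ℕ) :
    mixedSum (r + 1) - mixedSum r
      = (2 * (harmonic (2 * r + 1) : ℝ) - (harmonic r : ℝ) - 2 * Real.log 2)
          * (16 * ((r : ℝ) + 1) / ((2 * (r : ℝ) + 3) ^ 2 * (2 * (r : ℝ) + 1) ^ 2))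
        - 4 * (1 / (2 * (r : ℝ) + 3) ^ 3)
        - Real.pi ^ 2 / 3 * (1 / ((2 * (r : ℝ) + 3) * (2 * (r : ℝ) + 1))) := by
  rw [mixedSum, mixedSum, Finset.sum_range_succ _ (r + 1), sum_one_div_two_mul_add_one]
  push_cast
  have h1 : 2 * (r : ℝ) + 1 ≠ 0 := by positivity
  have h2 : 2 * (r : ℝ) + 3 ≠ 0 := by positivity
  rw [show 2 * ((r : ℝ) + 1) + 1 = 2 * r + 3 by ring]
  field_simp
  ring

theorem momentSum_one :
    momentSum 1 = -4 + 4 * Real.log 2 + Real.pi ^ 2 / 6 - 1 / 2 * Real.log 2 ^ 2 * Real.pi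
      - 11 * Real.pi ^ 3 / 48 - 4 * catalanG * Real.log 2 + 8 * (trilog (1 + Complex.I)).im := by
  have h1 := momentSum_add_succ 0
  have h2 := momentSum_zero
  have h3 : mixedSum 0 = Real.pi ^ 2 / 6 - 2 * (2 - 2 * Real.log 2) := by
    simp [mixedSum]
  rw [zero_add] at h1
  linarith

theorem momentSum_two :
    momentSum 2 = 92 / 27 - 32 * Real.log 2 / 9 - Real.pi ^ 2 / 9
      + 1 / 2 * Real.log 2 ^ 2 * Real.pi
      + 11 * Real.pi ^ 3 / 48 + 4 * catalanG * Real.log 2 - 8 * (trilog (1 + Complex.I)).im := by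
  have h1 := momentSum_add_two 0
  have h2 := momentSum_zero
  -- At r = 0 the rational part is 2·16/9 - 4/27 = 92/27.
  have h3 := mixedSum_succ_sub 0
  simp only [zero_add, mul_zero, harmonic_zero, show harmonic 1 = 1 by simp [harmonic],
    Nat.cast_zero, Rat.cast_one, Rat.cast_zero] at h1 h3
  linarith

/-- The increments at r = 2j + 1 are added up. -/
theorem momentSum_odd (e : ℕ) :
    momentSum (2 * e + 1) = momentSum 1
      + 32 * ∑ j ∈ Finset.range e,
          ((j : ℝ) + 1) * (2 * (harmonic (4 * j + 3) : ℝ) - (harmonic (2 * j + 1) : ℝ))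
            / ((4 * (j : ℝ) + 5) ^ 2 * (4 * (j : ℝ) + 3) ^ 2)
      - 4 * ∑ j ∈ Finset.range e, 1 / (4 * (j : ℝ) + 5) ^ 3
      - Real.pi ^ 2 * (1 / 3 * ∑ j ∈ Finset.range e, 1 / ((4 * (j : ℝ) + 5) * (4 * (j : ℝ) + 3)))
      - Real.log 2 * (64 * ∑ j ∈ Finset.range e,
          ((j : ℝ) + 1) / ((4 * (j : ℝ) + 5) ^ 2 * (4 * (j : ℝ) + 3) ^ 2)) := by
  induction e with
  | zero => simp
  | succ e ih =>
    have h := mixedSum_succ_sub (2 * e + 1)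
    rw [show 2 * (e + 1) + 1 = 2 * e + 1 + 2 by ring, momentSum_add_two, add_sub_assoc, h, ih]
    simp only [Finset.sum_range_succ]
    rw [show 2 * (2 * e + 1) + 1 = 4 * e + 3 by ring]
    push_cast
    rw [show 2 * (2 * (e : ℝ) + 1) + 3 = 4 * e + 5 by ring,
      show 2 * (2 * (e : ℝ) + 1) + 1 = 4 * e + 3 by ring]
    ring

/-- The increments at r = 2j are added up; j starts at 1 because the one at j = 0 is already
contained in `momentSum 2`. -/
theorem momentSum_even (e : ℕ) :
    momentSum (2 * e + 2) = momentSum 2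
      + 16 * ∑ j ∈ Finset.Icc 1 e,
          (2 * (j : ℝ) + 1) * (2 * (harmonic (4 * j + 1) : ℝ) - (harmonic (2 * j) : ℝ))
            / ((4 * (j : ℝ) + 3) ^ 2 * (4 * (j : ℝ) + 1) ^ 2)
      - 4 * ∑ j ∈ Finset.Icc 1 e, 1 / (4 * (j : ℝ) + 3) ^ 3
      - Real.pi ^ 2 * (1 / 3 * ∑ j ∈ Finset.Icc 1 e, 1 / ((4 * (j : ℝ) + 3) * (4 * (j : ℝ) + 1)))
      - Real.log 2 * (32 * ∑ j ∈ Finset.Icc 1 e,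
          (2 * (j : ℝ) + 1) / ((4 * (j : ℝ) + 3) ^ 2 * (4 * (j : ℝ) + 1) ^ 2)) := by
  induction e with
  | zero => simp
  | succ e ih =>
    have h := mixedSum_succ_sub (2 * (e + 1))
    rw [momentSum_add_two, add_sub_assoc, h,
      show 2 * (e + 1) = 2 * e + 2 by ring, ih]
    simp only [Finset.sum_Icc_succ_top (Nat.le_add_left 1 e)]
    rw [show 2 * (2 * e + 2) + 1 = 4 * (e + 1) + 1 by ring, show 2 * (e + 1) = 2 * e + 2 by ring]
    push_cast
    rw [show 2 * (2 * (e : ℝ) + 2) + 3 = 4 * (e + 1) + 3 by ring,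
      show 2 * (2 * (e : ℝ) + 2) + 1 = 4 * (e + 1) + 1 by ring]
    ring

theorem sum_arctanMoment_div_sq (m d : ℕ) :
    ∑ k ∈ Finset.Icc 1 m, arctanMoment (k + (d + 1)) / (k : ℝ) ^ 2
      = ∑ k ∈ Finset.Icc 1 m, ∑ j ∈ Finset.Icc 0 (k + d),
          (-1 : ℝ) ^ (j + k + d) / ((k : ℝ) ^ 2 * (2 * (j : ℝ) + 1))
        - (-1 : ℝ) ^ d * (∑ k ∈ Finset.Icc 1 m, (-1 : ℝ) ^ k / (4 * (k : ℝ) ^ 2)) * Real.pi := by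
  rw [Finset.mul_sum, Finset.sum_mul, ← Finset.sum_sub_distrib]
  refine Finset.sum_congr rfl fun k _ => ?_
  have h : ∑ j ∈ Finset.Icc 0 (k + d), (-1 : ℝ) ^ (j + k + d) / ((k : ℝ) ^ 2 * (2 * (j : ℝ) + 1))
      = (-1) ^ (k + d) / (k : ℝ) ^ 2
        * ∑ j ∈ Finset.range (k + (d + 1)), (-1) ^ j / (2 * (j : ℝ) + 1) := by
    rw [← Finset.Ico_add_one_right_eq_Icc, Finset.mul_sum, ← Finset.range_eq_Ico]
    refine Finset.sum_congr rfl fun j _ => ?_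
    rw [div_mul_div_comm, ← pow_add]
    congr 2
    ring
  rw [arctanMoment_eq, h]
  ring

theorem theorem7 (n m : ℕ) (hm : 0 < m) (hmn : m ≤ n) :
    (n = m →
      HasSum (fun k : ℕ => theta1Term n (2 * m) (k + 1))
        ((-4
          - ∑ k ∈ Finset.Icc 1 m, ∑ j ∈ Finset.Icc 0 k,
              (-1 : ℝ) ^ (k + j) / ((k : ℝ) ^ 2 * (2 * (j : ℝ) + 1))
          + 4 * Real.log 2
          - (1 / 2 * Real.log 2 ^ 2
              + ∑ k ∈ Finset.Icc 1 m, (-1 : ℝ) ^ (k - 1) / (4 * (k : ℝ) ^ 2)) * Real.pi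
          + Real.pi ^ 2 / 6 - 11 * Real.pi ^ 3 / 48 - 4 * catalanG * Real.log 2
          + 8 * (trilog (1 + Complex.I)).im : ℝ) : ℂ)) ∧
    (n = m + 1 →
      HasSum (fun k : ℕ => theta1Term n (2 * m) (k + 1))
        ((92 / 27
          + ∑ k ∈ Finset.Icc 1 m, ∑ j ∈ Finset.Icc 0 (k + 1),
              (-1 : ℝ) ^ (k + j) / ((k : ℝ) ^ 2 * (2 * (j : ℝ) + 1))
          + (1 / 2 * Real.log 2 ^ 2
              - ∑ k ∈ Finset.Icc 1 m, (-1 : ℝ) ^ k / (4 * (k : ℝ) ^ 2)) * Real.pi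
          - Real.pi ^ 2 / 9 + 11 * Real.pi ^ 3 / 48 + 4 * catalanG * Real.log 2
          - 32 * Real.log 2 / 9
          - 8 * (trilog (1 + Complex.I)).im : ℝ) : ℂ)) ∧
    (Odd (n - m) → n - m ≠ 1 →
      HasSum (fun k : ℕ => theta1Term n (2 * m) (k + 1))
        ((92 / 27
          + 16 * ∑ j ∈ Finset.Icc 1 ((n - m - 1) / 2),
              (2 * (j : ℝ) + 1) * (2 * (harmonic (4 * j + 1) : ℝ) - (harmonic (2 * j) : ℝ))
                / ((4 * (j : ℝ) + 3) ^ 2 * (4 * (j : ℝ) + 1) ^ 2)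
          - 4 * ∑ j ∈ Finset.Icc 1 ((n - m - 1) / 2), 1 / (4 * (j : ℝ) + 3) ^ 3
          - ∑ k ∈ Finset.Icc 1 m, ∑ j ∈ Finset.Icc 0 (k + (n - m)),
              (-1 : ℝ) ^ (j + k + (n - m)) / ((k : ℝ) ^ 2 * (2 * (j : ℝ) + 1))
          + (1 / 2 * Real.log 2 ^ 2
              + (-1 : ℝ) ^ (n - m)
                * ∑ k ∈ Finset.Icc 1 m, (-1 : ℝ) ^ k / (4 * (k : ℝ) ^ 2)) * Real.pi
          - Real.pi ^ 2 * (1 / 9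
              + 1 / 3 * ∑ j ∈ Finset.Icc 1 ((n - m - 1) / 2),
                  1 / ((4 * (j : ℝ) + 3) * (4 * (j : ℝ) + 1)))
          - Real.log 2 * (32 / 9
              + 32 * ∑ j ∈ Finset.Icc 1 ((n - m - 1) / 2),
                  (2 * (j : ℝ) + 1) / ((4 * (j : ℝ) + 3) ^ 2 * (4 * (j : ℝ) + 1) ^ 2))
          + 11 * Real.pi ^ 3 / 48 + 4 * catalanG * Real.log 2
          - 8 * (trilog (1 + Complex.I)).im : ℝ) : ℂ)) ∧
    -- for even `n - m`, `Finset.range ((n - m) / 2)` is `{0, …, (n - m - 2) / 2}`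
    (Even (n - m) →
      HasSum (fun k : ℕ => theta1Term n (2 * m) (k + 1))
        ((-4
          + 32 * ∑ j ∈ Finset.range ((n - m) / 2),
              ((j : ℝ) + 1) * (2 * (harmonic (4 * j + 3) : ℝ) - (harmonic (2 * j + 1) : ℝ))
                / ((4 * (j : ℝ) + 5) ^ 2 * (4 * (j : ℝ) + 3) ^ 2)
          - 4 * ∑ j ∈ Finset.range ((n - m) / 2), 1 / (4 * (j : ℝ) + 5) ^ 3
          - ∑ k ∈ Finset.Icc 1 m, ∑ j ∈ Finset.Icc 0 (k + (n - m)),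
              (-1 : ℝ) ^ (j + k + (n - m)) / ((k : ℝ) ^ 2 * (2 * (j : ℝ) + 1))
          + (-(1 / 2) * Real.log 2 ^ 2
              + (-1 : ℝ) ^ (n - m)
                * ∑ k ∈ Finset.Icc 1 m, (-1 : ℝ) ^ k / (4 * (k : ℝ) ^ 2)) * Real.pi
          + Real.pi ^ 2 * (1 / 6
              - 1 / 3 * ∑ j ∈ Finset.range ((n - m) / 2),
                  1 / ((4 * (j : ℝ) + 5) * (4 * (j : ℝ) + 3)))
          + Real.log 2 * (4
              - 64 * ∑ j ∈ Finset.range ((n - m) / 2),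
                  ((j : ℝ) + 1) / ((4 * (j : ℝ) + 5) ^ 2 * (4 * (j : ℝ) + 3) ^ 2))
          - 11 * Real.pi ^ 3 / 48 - 4 * catalanG * Real.log 2
          + 8 * (trilog (1 + Complex.I)).im : ℝ) : ℂ)) := by
  obtain ⟨d, rfl⟩ := Nat.exists_eq_add_of_le hmn
  have key := hasSum_theta1Term m d
  rw [sum_arctanMoment_div_sq] at key
  rw [Nat.add_sub_cancel_left]
  refine ⟨fun h => ?_, fun h => ?_, fun h _ => ?_, fun h => ?_⟩
  · obtain rfl : d = 0 := by omega
    convert key using 2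
    have e1 : ∑ k ∈ Finset.Icc 1 m, ∑ j ∈ Finset.Icc 0 (k + 0),
        (-1 : ℝ) ^ (j + k + 0) / ((k : ℝ) ^ 2 * (2 * (j : ℝ) + 1))
        = ∑ k ∈ Finset.Icc 1 m, ∑ j ∈ Finset.Icc 0 k,
          (-1 : ℝ) ^ (k + j) / ((k : ℝ) ^ 2 * (2 * (j : ℝ) + 1)) :=
      Finset.sum_congr rfl fun k _ => Finset.sum_congr rfl fun j _ => by
        rw [add_zero, add_comm j k]
    have e2 : ∑ k ∈ Finset.Icc 1 m, (-1 : ℝ) ^ (k - 1) / (4 * (k : ℝ) ^ 2)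
        = -∑ k ∈ Finset.Icc 1 m, (-1 : ℝ) ^ k / (4 * (k : ℝ) ^ 2) := by
      rw [← Finset.sum_neg_distrib]
      refine Finset.sum_congr rfl fun k hk => ?_
      -- Since k ≥ 1, the truncated subtraction in the exponent k - 1 is a true one.
      obtain ⟨i, rfl⟩ := Nat.exists_eq_add_of_le (Finset.mem_Icc.1 hk).1
      rw [Nat.add_sub_cancel_left, pow_add]
      ring
    rw [e1, e2, zero_add, momentSum_one]
    ring
  · obtain rfl : d = 1 := by omega
    convert key using 2
    have e1 : ∑ k ∈ Finset.Icc 1 m, ∑ j ∈ Finset.Icc 0 (k + 1),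
        (-1 : ℝ) ^ (j + k + 1) / ((k : ℝ) ^ 2 * (2 * (j : ℝ) + 1))
        = -∑ k ∈ Finset.Icc 1 m, ∑ j ∈ Finset.Icc 0 (k + 1),
          (-1 : ℝ) ^ (k + j) / ((k : ℝ) ^ 2 * (2 * (j : ℝ) + 1)) := by
      rw [← Finset.sum_neg_distrib]
      refine Finset.sum_congr rfl fun k _ => ?_
      rw [← Finset.sum_neg_distrib]
      refine Finset.sum_congr rfl fun j _ => ?_
      rw [pow_succ, add_comm j k]
      ring
    rw [e1, show 1 + 1 = 2 from rfl, momentSum_two]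
    ring
  · obtain ⟨e, rfl⟩ := h
    convert key using 2
    rw [show (2 * e + 1 - 1) / 2 = e by omega, show 2 * e + 1 + 1 = 2 * e + 2 by ring,
      momentSum_even, momentSum_two]
    ring
  · obtain ⟨e, he⟩ := h
    obtain rfl : d = 2 * e := by omega
    convert key using 2
    rw [show 2 * e / 2 = e by omega, momentSum_odd, momentSum_one]
    ring
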